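/- Let $m\ge 1$ be an integer and let $n=m(m-1)/2$. Then there exist integers $a_0,a_1,\dots,a_n$, depending only on $m$, with the following property. For every finite field $\mathbb F_q$, every $m$-dimensional vector space $W$ over $\mathbb F_q$ (for instance $W=\mathbb F_q^m$), every subgroup $G\le \mathrm{GL}(W)$ and every set $A\subseteq \mathrm{End}(W)$ of nilpotent endomorphisms such that $gAg^{-1}\subseteq A$ for all $g\in G$, $$\xi_{[1,m-1]}(G,A)=\sum_{j=0}^n a_j\,\gamma\bigl(G^{(j)},A^{(j)}_{\mathcal N}\bigr).$$ Here $\gamma(H,X)$ denotes the number of orbits of a group $H$ on a finite set $X$, and the other notation is as follows. * $\xi_{[1,m-1]}(G,A)$ is the number of $G$-orbits on the set of tuples $(W_1,\dots,W_{m-1},R)$ in which $W\ge W_1\ge W_2\ge\cdots\ge W_{m-1}$ are subspaces with $\dim W_i=m-i$, $R\in A$, and $R(W_i)\subseteq W_i$ for all $i$; an element $g\in G$ acts by $(W_1,\dots,W_{m-1},R)\mapsto (gW_1,\dots,gW_{m-1},gRg^{-1})$. * For $j\ge 0$ let $Q^j$ be the quiver representation $V\hookrightarrow Z\twoheadrightarrow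 W$ given by a short exact sequence with $\dim V=j$ (unique up to isomorphism; take $V=\mathbb F_q^j$ and $Z=\mathbb F_q^j\oplus W$ with the standard inclusion and projection). Its endomorphism ring $\mathrm{End}(Q^j)$ consists of the triples $(X_V,X_Z,X_W)\in \mathrm{End}(V)\times\mathrm{End}(Z)\times\mathrm{End}(W)$ that commute with the two maps, and $\mathrm{Aut}(Q^j)=\mathrm{End}(Q^j)^\times$ acts on it by conjugation. Then $G^{(j)}$ is the group of all $(g_V,g_Z,g_W)\in\mathrm{Aut}(Q^j)$ with $g_W\in G$, and $A^{(j)}_{\mathcal N}$ is the set of all nilpotent $(X_V,X_Z,X_W)\in\mathrm{End}(Q^j)$ with $X_W\in A$. -/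

import Mathlib

namespace FlagOrbits

/-- The number of orbits of the subgroup `G` on the (`G`-stable) set `S`, where the ambient group
acts on `X` through the homomorphism `ρ`. -/
noncomputable def orbitCount {M X : Type*} [Group M] (ρ : M →* Equiv.Perm X)
    (G : Subgroup M) (S : Set X) : ℕ :=
  ((fun x : X => {y : X | ∃ g ∈ G, ρ g x = y}) '' S).ncard

/-- The action of the unit group of a ring on the ring by conjugation, `x ↦ g x g⁻¹`. -/
def conjAction (R : Type*) [Ring R] : Rˣ →* Equiv.Perm R where
  toFun g :=
    { toFun := fun x => (g : R) * x * ((g⁻¹ : Rˣ) : R)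
      invFun := fun x => ((g⁻¹ : Rˣ) : R) * x * (g : R)
      left_inv := fun x => by simp [mul_assoc]
      right_inv := fun x => by simp [mul_assoc] }
  map_one' := by
    ext x
    simp
  map_mul' g h := by
    ext x
    simp [mul_assoc]

section Sequence

variable {K V Z W : Type*} [Field K]
  [AddCommGroup V] [Module K V] [AddCommGroup Z] [Module K Z] [AddCommGroup W] [Module K W]

/-- The endomorphism ring of the quiver representation `V --i--> Z --p--> W`: all triples
`(X_V, X_Z, X_W)` of endomorphisms with `i X_V = X_Z i` and `p X_Z = X_W p`. -/
def endRing (i : V →ₗ[K] Z) (p : Z →ₗ[K] W) :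
    Subring (Module.End K V × Module.End K Z × Module.End K W) where
  carrier := {X | i ∘ₗ X.1 = X.2.1 ∘ₗ i ∧ p ∘ₗ X.2.1 = X.2.2 ∘ₗ p}
  one_mem' := ⟨rfl, rfl⟩
  zero_mem' := by
    constructor <;> ext <;> simp
  mul_mem' := by
    rintro X Y ⟨hX, hX'⟩ ⟨hY, hY'⟩
    have e1 := LinearMap.congr_fun hX
    have e2 := LinearMap.congr_fun hX'
    have e3 := LinearMap.congr_fun hY
    have e4 := LinearMap.congr_fun hY'
    simp only [LinearMap.comp_apply] at e1 e2 e3 e4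
    constructor <;> apply LinearMap.ext <;> intro v <;>
      simp [e1, e2, e3, e4]
  add_mem' := by
    rintro X Y ⟨hX, hX'⟩ ⟨hY, hY'⟩
    exact ⟨by simp only [Prod.fst_add, Prod.snd_add, LinearMap.comp_add, LinearMap.add_comp, hX, hY],
      by simp only [Prod.snd_add, Prod.fst_add, LinearMap.comp_add, LinearMap.add_comp, hX', hY']⟩
  neg_mem' := by
    rintro X ⟨hX, hX'⟩
    exact ⟨by simp only [Prod.fst_neg, Prod.snd_neg, LinearMap.comp_neg, LinearMap.neg_comp, hX],
      by simp only [Prod.snd_neg, Prod.fst_neg, LinearMap.comp_neg, LinearMap.neg_comp, hX']⟩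

/-- The projection `(X_V, X_Z, X_W) ↦ X_W`. -/
def projEnd (i : V →ₗ[K] Z) (p : Z →ₗ[K] W) : endRing i p →+* Module.End K W :=
  ((RingHom.snd _ _).comp (RingHom.snd _ _)).comp (endRing i p).subtype

/-- The automorphisms of `V --i--> Z --p--> W` whose component at `W` lies in `G`. -/
def liftGroup (i : V →ₗ[K] Z) (p : Z →ₗ[K] W) (G : Subgroup (Module.End K W)ˣ) :
    Subgroup (endRing i p)ˣ :=
  G.comap (Units.map (projEnd i p : endRing i p →* Module.End K W))

/-- The nilpotent endomorphisms of `V --i--> Z --p--> W` whose component at `W` lies in `A`. -/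
def liftNilpotent (i : V →ₗ[K] Z) (p : Z →ₗ[K] W) (A : Set (Module.End K W)) :
    Set (endRing i p) :=
  {X | projEnd i p X ∈ A ∧ IsNilpotent X}

end Sequence

section Counts

variable {K W : Type*} [Field K] [AddCommGroup W] [Module K W]

/-- `γ(G⁽ᵏ⁾, A⁽ᵏ⁾_N)`: here `Qᵏ` is the short exact sequence `Kᵏ ↪ Kᵏ × W ↠ W` (every short exact
sequence `V ↪ Z ↠ W` with `dim V = k` is isomorphic to it), `G⁽ᵏ⁾` is the preimage of `G` in
`Aut Qᵏ`, and `A⁽ᵏ⁾_N` is the set of nilpotent elements of the preimage of `A` in `End Qᵏ`. -/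
noncomputable def gammaLift (k : ℕ) (G : Subgroup (Module.End K W)ˣ)
    (A : Set (Module.End K W)) : ℕ :=
  orbitCount
    (conjAction (endRing (LinearMap.inl K (Fin k → K) W) (LinearMap.snd K (Fin k → K) W)))
    (liftGroup (LinearMap.inl K (Fin k → K) W) (LinearMap.snd K (Fin k → K) W) G)
    (liftNilpotent (LinearMap.inl K (Fin k → K) W) (LinearMap.snd K (Fin k → K) W) A)

/-- The action of `GL(W)` on pairs (sequence of `s` subspaces, endomorphism), by
`g • (W₁, …, W_s, R) = (g W₁, …, g W_s, g R g⁻¹)`. -/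
def flagAction (K W : Type*) [Field K] [AddCommGroup W] [Module K W] (s : ℕ) :
    (Module.End K W)ˣ →* Equiv.Perm ((Fin s → Submodule K W) × Module.End K W) where
  toFun g :=
    { toFun := fun x => (fun i => (x.1 i).map (g : Module.End K W), conjAction _ g x.2)
      invFun := fun x =>
        (fun i => (x.1 i).map ((g⁻¹ : (Module.End K W)ˣ) : Module.End K W), (conjAction _ g).symm x.2)
      left_inv := fun x => by
        refine Prod.ext (funext fun i => ?_) (by simp)
        simp only [← Submodule.map_comp, ← Module.End.mul_eq_comp, Units.inv_mul,
          Module.End.one_eq_id, Submodule.map_id]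
      right_inv := fun x => by
        refine Prod.ext (funext fun i => ?_) (by simp)
        simp only [← Submodule.map_comp, ← Module.End.mul_eq_comp, Units.mul_inv,
          Module.End.one_eq_id, Submodule.map_id] }
  map_one' := by
    ext1 x
    refine Prod.ext (funext fun i => ?_) (by simp)
    simp [Module.End.one_eq_id]
  map_mul' g h := by
    ext1 x
    refine Prod.ext (funext fun i => ?_) (by simp)
    simp [Module.End.mul_eq_comp, Submodule.map_comp]

/-- `T_l(A)`: the pairs consisting of a flag `W ≥ W₁ ≥ ⋯ ≥ W_s` with `dim W_i = l_i` and an element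
`R` of `A` with `R(W_i) ⊆ W_i` for all `i`. -/
def flagPairs {s : ℕ} (l : Fin s → ℕ) (A : Set (Module.End K W)) :
    Set ((Fin s → Submodule K W) × Module.End K W) :=
  {x | Antitone x.1 ∧ (∀ i, Module.finrank K (x.1 i) = l i) ∧ x.2 ∈ A ∧
    ∀ i, (x.1 i).map x.2 ≤ x.1 i}

/-- `ξ_l(G, A)`: the number of `G`-orbits on `T_l(A)`. -/
noncomputable def xi {s : ℕ} (l : Fin s → ℕ) (G : Subgroup (Module.End K W)ˣ)
    (A : Set (Module.End K W)) : ℕ :=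
  orbitCount (flagAction K W s) G (flagPairs l A)

end Counts

/-- The decreasing sequence `(m-1, m-2, …, 1)`, which lists the set `[1, m-1]`. -/
def staircase (m : ℕ) : Fin (m - 1) → ℕ := fun i => m - 1 - i

end FlagOrbits

/-! Multiply by |G| and apply Cauchy–Frobenius to both kinds of orbit count: everything becomes a
sum over commuting pairs (g, R) in G × A, and an identity for a single pair suffices. The flag count
contributes the number of complete flags stable under g and R. A lift of (g, R) to V × W is a pair
of block triangular matrices; for fixed diagonal blocks (h, S) on V, commutation is a linear
condition on the corners, and the trace pairing identifies the dual of its cokernel with Hom((V, h,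
S), (W, g, R)). So γ for V = K^j contributes the j-th coefficient of F_W, where F_N (`nilSeries`)
counts commuting pairs (h, S) on K^j, h invertible and S nilpotent, with a homomorphism into N,
weighted by 1/|GL_j| (`gammaLift_mul_natCard`).

Sorting homomorphisms by their image gives F_N = ∑ t^(dim N') F_N' over the stable N' ≤ N
(`nilSeries_eq_sum`). Hence, with d = dim N, (1 - t)⋯(1 - t^d) F_N = P_N F_0 for a polynomial P_N of
degree at most d(d-1)/2. At t = 1 only the hyperplanes of N survive in the recursion, so P_N(1) is
the number of stable complete flags (`exists_polynomial_eval_one_eq_natCard_stableFlags`).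

Finally F_0 counts nilpotent similarity classes: an integral series with constant term 1 that
depends on neither the field nor the pair (`nilSeries_bot`). So P_W = F_W · C with C = ∏ (1 - t^i) /
F_0 universal and integral, and P_W(1), a sum of finitely many coefficients, is a combination of
coefficients of F_W weighted by partial sums of C. These partial sums are the a_j. -/

namespace FlagOrbits

/-! ### Block triangular endomorphisms -/

section Blocks

variable {K L N : Type*} [Field K] [AddCommGroup L] [Module K L] [AddCommGroup N] [Module K N]

/-- The endomorphism of `L × N` with block matrix `(S, f; 0, R)`. -/
def block (S : Module.End K L) (f : N →ₗ[K] L) (R : Module.End K N) : Module.End K (L × N) :=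
  (S.coprod f).prod (R ∘ₗ LinearMap.snd K L N)

@[simp] theorem block_apply (S : Module.End K L) (f : N →ₗ[K] L) (R : Module.End K N) (x : L × N) :
    block S f R x = (S x.1 + f x.2, R x.2) := rfl

theorem block_injective {S S' : Module.End K L} {f f' : N →ₗ[K] L} {R R' : Module.End K N}
    (h : block S f R = block S' f' R') : S = S' ∧ f = f' ∧ R = R' := by
  have h1 := fun x => LinearMap.congr_fun h x
  refine ⟨LinearMap.ext fun l => ?_, LinearMap.ext fun n => ?_, LinearMap.ext fun n => ?_⟩
  · simpa using (h1 (l, 0))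
  · simpa using congrArg Prod.fst (h1 (0, n))
  · simpa using congrArg Prod.snd (h1 (0, n))

theorem block_mul (S S' : Module.End K L) (f f' : N →ₗ[K] L) (R R' : Module.End K N) :
    block S f R * block S' f' R' = block (S * S') (S ∘ₗ f' + f ∘ₗ R') (R * R') := by
  refine LinearMap.ext fun x => ?_
  simp [add_assoc]

theorem snd_comp_eq_iff (X : Module.End K (L × N)) (R : Module.End K N) :
    LinearMap.snd K L N ∘ₗ X = R ∘ₗ LinearMap.snd K L N ↔ ∃ S f, X = block S f R := by
  constructor
  · intro h
    refine ⟨LinearMap.fst K L N ∘ₗ X ∘ₗ LinearMap.inl K L N,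
      LinearMap.fst K L N ∘ₗ X ∘ₗ LinearMap.inr K L N, LinearMap.ext fun x => Prod.ext ?_ ?_⟩
    · have : X x = X (x.1, 0) + X (0, x.2) := by rw [← map_add]; simp
      simp [this]
    · simpa using LinearMap.congr_fun h x
  · rintro ⟨S, f, rfl⟩
    rfl

theorem block_pow (S : Module.End K L) (f : N →ₗ[K] L) (R : Module.End K N) (n : ℕ) :
    ∃ f', block S f R ^ n = block (S ^ n) f' (R ^ n) := by
  induction n with
  | zero => exact ⟨0, LinearMap.ext fun x => by simp⟩
  | succ n ih =>
    obtain ⟨f', h⟩ := ih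
    exact ⟨_, by rw [pow_succ, h, block_mul, ← pow_succ, ← pow_succ]⟩

theorem isNilpotent_block (S : Module.End K L) (f : N →ₗ[K] L) (R : Module.End K N) :
    IsNilpotent (block S f R) ↔ IsNilpotent S ∧ IsNilpotent R := by
  have h0 : (0 : Module.End K (L × N)) = block 0 0 0 := LinearMap.ext fun x => by simp; rfl
  constructor
  · rintro ⟨n, hn⟩
    obtain ⟨f', h⟩ := block_pow S f R n
    rw [h, h0] at hn
    exact ⟨⟨n, (block_injective hn).1⟩, ⟨n, (block_injective hn).2.2⟩⟩
  · rintro ⟨⟨a, ha⟩, ⟨b, hb⟩⟩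
    obtain ⟨f₁, h₁⟩ := block_pow S f R a
    obtain ⟨f₂, h₂⟩ := block_pow S f R b
    -- A block matrix with zero upper left entry times one with zero lower right entry vanishes.
    refine ⟨a + b, ?_⟩
    rw [pow_add, h₁, h₂, ha, hb, block_mul, h0]
    simp

variable [FiniteDimensional K L] [FiniteDimensional K N]

/-- A triangular unit directly gives only injectivity of S and surjectivity of R; finite dimension
upgrades both. -/
theorem isUnit_block (S : Module.End K L) (f : N →ₗ[K] L) (R : Module.End K N) :
    IsUnit (block S f R) ↔ IsUnit S ∧ IsUnit R := by
  constructor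
  · intro h
    have hb := (Module.End.isUnit_iff _).1 h
    constructor
    · rw [LinearMap.isUnit_iff_ker_eq_bot, LinearMap.ker_eq_bot']
      intro l hl
      have := hb.1 (a₁ := (l, 0)) (a₂ := 0) (by simp [hl])
      simpa using this
    · rw [LinearMap.isUnit_iff_range_eq_top, LinearMap.range_eq_top]
      intro n
      obtain ⟨x, hx⟩ := hb.2 (0, n)
      exact ⟨x.2, congrArg Prod.snd hx⟩
  · rintro ⟨hS, hR⟩
    rw [LinearMap.isUnit_iff_ker_eq_bot, LinearMap.ker_eq_bot'] at hS hR ⊢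
    rintro ⟨l, n⟩ h
    have hn : n = 0 := hR n (congrArg Prod.snd h)
    subst hn
    have hl : l = 0 := hS l (by simpa using congrArg Prod.fst h)
    simp [hl]

end Blocks

/-! ### Trace duality and the commutation condition -/

section Duality

variable {K : Type*} [Field K]

/-- The linear maps that intertwine `(h, S)` with `(g, R)`. -/
def intertwiners {V W : Type*} [AddCommGroup V] [Module K V] [AddCommGroup W] [Module K W]
    (h S : Module.End K V) (g R : Module.End K W) : Submodule K (V →ₗ[K] W) where
  carrier := {φ | φ ∘ₗ h = g ∘ₗ φ ∧ φ ∘ₗ S = R ∘ₗ φ}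
  add_mem' := by
    rintro a b ⟨h1, h2⟩ ⟨h3, h4⟩
    constructor <;> simp [LinearMap.add_comp, LinearMap.comp_add, *]
  zero_mem' := by constructor <;> simp
  smul_mem' := by
    rintro c a ⟨h1, h2⟩
    constructor <;> simp [LinearMap.smul_comp, LinearMap.comp_smul, *]

variable {L N : Type*} [AddCommGroup L] [Module K L] [AddCommGroup N] [Module K N]

/-- The obstruction for `block h α g` and `block S β R` to commute. -/
def commutatorMap (h S : Module.End K L) (g R : Module.End K N) :
    (N →ₗ[K] L) × (N →ₗ[K] L) →ₗ[K] (N →ₗ[K] L) where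
  toFun x := (h ∘ₗ x.2 - x.2 ∘ₗ g) - (S ∘ₗ x.1 - x.1 ∘ₗ R)
  map_add' x y := by
    simp only [Prod.fst_add, Prod.snd_add, LinearMap.comp_add, LinearMap.add_comp]
    abel
  map_smul' c x := by
    simp only [Prod.smul_fst, Prod.smul_snd, LinearMap.comp_smul, LinearMap.smul_comp,
      RingHom.id_apply, smul_sub]

theorem commutatorMap_apply (h S : Module.End K L) (g R : Module.End K N)
    (x : (N →ₗ[K] L) × (N →ₗ[K] L)) :
    commutatorMap h S g R x = (h ∘ₗ x.2 - x.2 ∘ₗ g) - (S ∘ₗ x.1 - x.1 ∘ₗ R) := rfl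

/-- The trace pairing between `Hom(L, N)` and `Hom(N, L)`. -/
noncomputable def tracePairing (K L N : Type*) [Field K] [AddCommGroup L] [Module K L]
    [AddCommGroup N] [Module K N] :
    (L →ₗ[K] N) →ₗ[K] Module.Dual K (N →ₗ[K] L) :=
  LinearMap.mk₂ K (fun φ β => LinearMap.trace K N (φ ∘ₗ β))
    (fun a b c => by simp [LinearMap.add_comp]) (fun a b c => by simp [LinearMap.smul_comp])
    (fun a b c => by simp [LinearMap.comp_add]) (fun a b c => by simp [LinearMap.comp_smul])

theorem tracePairing_apply (φ : L →ₗ[K] N) (β : N →ₗ[K] L) :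
    tracePairing K L N φ β = LinearMap.trace K N (φ ∘ₗ β) := rfl

/-- Cyclicity of the trace: the adjoint of `commutatorMap` sends φ, up to sign, to its two failures
to intertwine. -/
theorem tracePairing_comp_commutatorMap (h S : Module.End K L) (g R : Module.End K N)
    (φ : L →ₗ[K] N) (x : (N →ₗ[K] L) × (N →ₗ[K] L)) :
    tracePairing K L N φ (commutatorMap h S g R x) =
      tracePairing K L N (φ ∘ₗ h - g ∘ₗ φ) x.2 - tracePairing K L N (φ ∘ₗ S - R ∘ₗ φ) x.1 := by
  have key : ∀ (a : Module.End K L) (b : Module.End K N) (y : N →ₗ[K] L),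
      tracePairing K L N φ (a ∘ₗ y - y ∘ₗ b) = tracePairing K L N (φ ∘ₗ a - b ∘ₗ φ) y := by
    intro a b y
    rw [map_sub, map_sub, LinearMap.sub_apply]
    simp only [tracePairing_apply]
    congr 1
    rw [← LinearMap.comp_assoc, LinearMap.comp_assoc _ _ b]
    exact LinearMap.trace_mul_comm K (φ ∘ₗ y) b
  rw [commutatorMap_apply, map_sub, key, key]

variable [FiniteDimensional K N]

/-- Rank-one maps suffice: tr(φ ∘ (ℓ ⊗ l)) = ℓ(φ l). -/
theorem tracePairing_injective : Function.Injective (tracePairing K L N) := by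
  rw [← LinearMap.ker_eq_bot, LinearMap.ker_eq_bot']
  intro φ hφ
  refine LinearMap.ext fun l => ?_
  rw [LinearMap.zero_apply, ← Module.forall_dual_apply_eq_zero_iff K]
  intro ℓ
  have h := LinearMap.congr_fun hφ (ℓ.smulRight l)
  rw [tracePairing_apply] at h
  have e : φ ∘ₗ ℓ.smulRight l = ℓ.smulRight (φ l) := LinearMap.ext fun n => by simp
  rw [e, LinearMap.trace_smulRight] at h
  simpa using h

variable [FiniteDimensional K L]

/-- The intertwiners are the kernel of the dual map, hence dual to the cokernel. The source has
twice the dimension of the target, so rank–nullity leaves one copy of Hom(N, L) plus the cokernel.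
-/
theorem finrank_ker_commutatorMap (h S : Module.End K L) (g R : Module.End K N) :
    Module.finrank K (LinearMap.ker (commutatorMap h S g R)) =
      Module.finrank K (N →ₗ[K] L) + Module.finrank K (intertwiners h S g R) := by
  have hfr : Module.finrank K (L →ₗ[K] N) = Module.finrank K (Module.Dual K (N →ₗ[K] L)) := by
    rw [Subspace.dual_finrank_eq, Module.finrank_linearMap, Module.finrank_linearMap, mul_comm]
  let τ := LinearEquiv.ofInjectiveOfFinrankEq (tracePairing K L N) tracePairing_injective hfr
  have hτ : ∀ φ, τ φ = tracePairing K L N φ := fun φ => rfl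
  have hmap : (intertwiners h S g R).map (τ : (L →ₗ[K] N) →ₗ[K] Module.Dual K (N →ₗ[K] L)) =
      LinearMap.ker (commutatorMap h S g R).dualMap := by
    ext y
    obtain ⟨φ, rfl⟩ := τ.surjective y
    rw [Submodule.mem_map_equiv, LinearEquiv.symm_apply_apply, LinearMap.mem_ker]
    have e : (commutatorMap h S g R).dualMap (τ φ) = 0 ↔
        ∀ x : (N →ₗ[K] L) × (N →ₗ[K] L), tracePairing K L N (φ ∘ₗ h - g ∘ₗ φ) x.2 -
          tracePairing K L N (φ ∘ₗ S - R ∘ₗ φ) x.1 = 0 := by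
      simp_rw [← tracePairing_comp_commutatorMap, LinearMap.ext_iff]
      rfl
    rw [e]
    constructor
    · rintro ⟨h1, h2⟩ x
      rw [h1, h2]
      simp
    · intro hx
      constructor
      · refine sub_eq_zero.1 (tracePairing_injective ?_)
        refine LinearMap.ext fun y => ?_
        have := hx (0, y)
        simp only [map_zero, sub_zero] at this
        rw [this, map_zero, LinearMap.zero_apply]
      · refine sub_eq_zero.1 (tracePairing_injective ?_)
        refine LinearMap.ext fun y => ?_
        have := hx (y, 0)
        simp only [map_zero, zero_sub, neg_eq_zero] at this
        rw [this, map_zero, LinearMap.zero_apply]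
  have e1 := LinearEquiv.finrank_map_eq τ (intertwiners h S g R)
  rw [hmap] at e1
  have e2 := LinearMap.finrank_range_add_finrank_ker (commutatorMap h S g R).dualMap
  have e3 := LinearMap.finrank_range_add_finrank_ker (commutatorMap h S g R)
  have e4 := LinearMap.finrank_range_dualMap_eq_finrank_range (commutatorMap h S g R)
  rw [Module.finrank_prod] at e3
  rw [Subspace.dual_finrank_eq] at e2
  omega

end Duality

/-! ### Counting by fibres -/

theorem natCard_prod_set {A B : Type*} [Fintype A] [Finite B] (s : Set (A × B)) :
    Nat.card s = ∑ a, Nat.card {b // (a, b) ∈ s} := by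
  rw [← Nat.card_sigma]
  exact Nat.card_congr
    { toFun := fun x => ⟨x.1.1, x.1.2, x.2⟩
      invFun := fun x => ⟨(x.1, x.2.1), x.2.2⟩
      left_inv := fun x => rfl
      right_inv := fun x => rfl }

theorem natCard_eq_sum_fiber {A B : Type*} [Finite A] [Fintype B] (f : A → B) :
    Nat.card A = ∑ b, Nat.card {a // f a = b} := by
  rw [← Nat.card_sigma]
  exact Nat.card_congr (Equiv.sigmaFiberEquiv f).symm

theorem natCard_eq_mul_of_fiber {A B : Type*} [Finite A] [Finite B] (f : A → B) (c : ℕ)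
    (h : ∀ b, Nat.card {a // f a = b} = c) : Nat.card A = Nat.card B * c := by
  cases nonempty_fintype B
  rw [natCard_eq_sum_fiber f]
  simp [h]

theorem natCard_units (M : Type*) [Monoid M] : Nat.card Mˣ = Nat.card {x : M // IsUnit x} :=
  Nat.card_congr (Submonoid.unitsTypeEquivIsUnitSubmonoid (M := M)).toEquiv

instance finite_linearMap {K V W : Type*} [Field K] [AddCommGroup V] [Module K V]
    [AddCommGroup W] [Module K W] [Finite V] [Finite W] : Finite (V →ₗ[K] W) :=
  DFunLike.finite _

/-! ### Counting lifts along a surjection -/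

section Lifts

variable {K : Type*} [Field K]

/-- The commuting pairs of an invertible and a nilpotent endomorphism. -/
def nilPairs (K V : Type*) [Field K] [AddCommGroup V] [Module K V] :
    Set (Module.End K V × Module.End K V) :=
  {x | IsUnit x.1 ∧ Commute x.1 x.2 ∧ IsNilpotent x.2}

/-- The pairs in `nilPairs K Z` that are mapped to `(g, R)` by `p`. -/
def lifts {Z N : Type*} [AddCommGroup Z] [Module K Z] [AddCommGroup N] [Module K N]
    (p : Z →ₗ[K] N) (g R : Module.End K N) : Set (Module.End K Z × Module.End K Z) :=
  {x | x ∈ nilPairs K Z ∧ p ∈ intertwiners x.1 x.2 g R}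

/-- The pairs in `nilPairs K V` together with a homomorphism to `(W, g, R)` whose range lies
in `N`. -/
def nilHoms (V : Type*) {W : Type*} [AddCommGroup V] [Module K V] [AddCommGroup W] [Module K W]
    (g R : Module.End K W) (N : Submodule K W) :
    Set ((Module.End K V × Module.End K V) × (V →ₗ[K] W)) :=
  {x | x.1 ∈ nilPairs K V ∧ x.2 ∈ intertwiners x.1.1 x.1.2 g R ∧ LinearMap.range x.2 ≤ N}

variable {L N Z : Type*} [AddCommGroup L] [Module K L] [AddCommGroup N] [Module K N]
  [AddCommGroup Z] [Module K Z]

theorem commute_block_iff (h S : Module.End K L) (g R : Module.End K N) (α β : N →ₗ[K] L)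
    (hgR : Commute g R) :
    Commute (block h α g) (block S β R) ↔ Commute h S ∧ commutatorMap h S g R (α, β) = 0 := by
  have e : commutatorMap h S g R (α, β) = (h ∘ₗ β + α ∘ₗ R) - (S ∘ₗ α + β ∘ₗ g) := by
    rw [commutatorMap_apply]
    abel
  rw [e, sub_eq_zero, Commute, SemiconjBy, block_mul, block_mul]
  constructor
  · intro hb
    exact ⟨(block_injective hb).1, (block_injective hb).2.1⟩
  · rintro ⟨h1, h2⟩
    rw [h1.eq, h2, hgR.eq]

variable [Finite L] [Finite N]

theorem block_mem_lifts (h S : Module.End K L) (g R : Module.End K N) (α β : N →ₗ[K] L)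
    (hgR : (g, R) ∈ nilPairs K N) :
    (block h α g, block S β R) ∈ lifts (LinearMap.snd K L N) g R ↔
      (h, S) ∈ nilPairs K L ∧ commutatorMap h S g R (α, β) = 0 := by
  have hu := isUnit_block h α g
  have hn := isNilpotent_block S β R
  have hc := commute_block_iff h S g R α β hgR.2.1
  have hg := hgR.1
  have hR := hgR.2.2
  have hi : LinearMap.snd K L N ∈ intertwiners (block h α g) (block S β R) g R := ⟨rfl, rfl⟩
  simp only [lifts, nilPairs, Set.mem_ofPred_eq] at *
  tauto

/-- For each admissible (h, S) the corners form `ker commutatorMap`, which has |Hom(N, L)| times as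
many elements as the space of intertwiners; this factor does not depend on (h, S). -/
theorem natCard_lifts_snd (g R : Module.End K N) (hgR : (g, R) ∈ nilPairs K N) :
    Nat.card (lifts (LinearMap.snd K L N) g R) =
      Nat.card (N →ₗ[K] L) * Nat.card (nilHoms L g R ⊤) := by
  let T : Set ((Module.End K L × Module.End K L) × ((N →ₗ[K] L) × (N →ₗ[K] L))) :=
    {x | x.1 ∈ nilPairs K L ∧ commutatorMap x.1.1 x.1.2 g R x.2 = 0}
  have hT : Nat.card T = Nat.card (lifts (LinearMap.snd K L N) g R) := by
    refine Nat.card_congr (Equiv.ofBijective (fun x => ⟨(block x.1.1.1 x.1.2.1 g,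
      block x.1.1.2 x.1.2.2 R), (block_mem_lifts _ _ g R _ _ hgR).2 x.2⟩) ⟨?_, ?_⟩)
    · rintro ⟨⟨⟨h, S⟩, α, β⟩, hx⟩ ⟨⟨⟨h', S'⟩, α', β'⟩, hx'⟩ e
      have e1 := congrArg Prod.fst (congrArg Subtype.val e)
      have e2 := congrArg Prod.snd (congrArg Subtype.val e)
      obtain ⟨a, b, -⟩ := block_injective e1
      obtain ⟨a', b', -⟩ := block_injective e2
      simp only at a b a' b'
      subst a b a' b'
      rfl
    · rintro ⟨⟨H, X⟩, hx⟩
      obtain ⟨h, α, rfl⟩ := (snd_comp_eq_iff H g).1 hx.2.1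
      obtain ⟨S, β, rfl⟩ := (snd_comp_eq_iff X R).1 hx.2.2
      exact ⟨⟨((h, S), (α, β)), (block_mem_lifts h S g R α β hgR).1 hx⟩, rfl⟩
  cases nonempty_fintype (Module.End K L × Module.End K L)
  rw [← hT, natCard_prod_set, natCard_prod_set, Finset.mul_sum]
  refine Finset.sum_congr rfl fun x _ => ?_
  by_cases hx : x ∈ nilPairs K L
  · have e1 : Nat.card {b // (x, b) ∈ T} =
        Nat.card (LinearMap.ker (commutatorMap x.1 x.2 g R)) :=
      Nat.card_congr (Equiv.subtypeEquivRight fun b => by simp [T, hx])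
    have e2 : Nat.card {b // (x, b) ∈ nilHoms L g R ⊤} = Nat.card (intertwiners x.1 x.2 g R) :=
      Nat.card_congr (Equiv.subtypeEquivRight fun b => by simp [nilHoms, hx])
    rw [e1, e2, Module.natCard_eq_pow_finrank (K := K), finrank_ker_commutatorMap, pow_add,
      ← Module.natCard_eq_pow_finrank, ← Module.natCard_eq_pow_finrank]
  · have e1 : IsEmpty {b // (x, b) ∈ T} := ⟨fun b => hx b.2.1⟩
    have e2 : IsEmpty {b // (x, b) ∈ nilHoms L g R ⊤} := ⟨fun b => hx b.2.1⟩
    simp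

theorem exists_equiv_prod_of_surjective [Finite Z] (p : Z →ₗ[K] N) (hp : Function.Surjective p)
    (hd : Module.finrank K Z = Module.finrank K L + Module.finrank K N) :
    ∃ e : Z ≃ₗ[K] L × N, LinearMap.snd K L N ∘ₗ (e : Z →ₗ[K] L × N) = p := by
  have hk : Module.finrank K (LinearMap.ker p) = Module.finrank K L := by
    have := LinearMap.finrank_range_add_finrank_ker p
    rw [LinearMap.range_eq_top.2 hp, finrank_top] at this
    omega
  obtain ⟨k⟩ := FiniteDimensional.nonempty_linearEquiv_of_finrank_eq hk
  obtain ⟨σ, hσ⟩ := p.exists_rightInverse_of_surjective (LinearMap.range_eq_top.2 hp)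
  have hσ' : ∀ n, p (σ n) = n := fun n => LinearMap.congr_fun hσ n
  let f : L × N →ₗ[K] Z := ((LinearMap.ker p).subtype ∘ₗ (k.symm : L →ₗ[K] LinearMap.ker p)).coprod σ
  have hf : ∀ x, p (f x) = x.2 := fun x => by simp [f, hσ']
  have hinj : Function.Injective f := by
    rw [← LinearMap.ker_eq_bot, LinearMap.ker_eq_bot']
    rintro ⟨l, n⟩ h
    have hn : n = 0 := by simpa [h] using (hf (l, n)).symm
    subst hn
    have hl : l = 0 := by simpa [f] using h
    simp [hl]
  let e := LinearEquiv.ofInjectiveOfFinrankEq f hinj (by rw [Module.finrank_prod, hd])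
  refine ⟨e.symm, LinearMap.ext fun z => ?_⟩
  obtain ⟨x, rfl⟩ := e.surjective z
  change (LinearMap.snd K L N) (e.symm (e x)) = _
  rw [e.symm_apply_apply]
  exact (hf x).symm

theorem natCard_lifts [Finite Z] (p : Z →ₗ[K] N) (hp : Function.Surjective p)
    (hd : Module.finrank K Z = Module.finrank K L + Module.finrank K N)
    (g R : Module.End K N) (hgR : (g, R) ∈ nilPairs K N) :
    Nat.card (lifts p g R) = Nat.card (N →ₗ[K] L) * Nat.card (nilHoms L g R ⊤) := by
  obtain ⟨e, he⟩ := exists_equiv_prod_of_surjective (L := L) p hp hd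
  rw [← natCard_lifts_snd g R hgR]
  let c := e.conjRingEquiv
  refine Nat.card_congr ((c.toEquiv.prodCongr c.toEquiv).subtypeEquiv ?_)
  rintro ⟨h, X⟩
  have hc : ∀ (Y : Module.End K Z) (Q : Module.End K N),
      p ∘ₗ Y = Q ∘ₗ p ↔ LinearMap.snd K L N ∘ₗ c Y = Q ∘ₗ LinearMap.snd K L N := by
    intro Y Q
    have hp' : ∀ z, p z = (e z).2 := fun z => (LinearMap.congr_fun he z).symm
    constructor
    · intro h
      refine LinearMap.ext fun x => ?_
      have := LinearMap.congr_fun h (e.symm x)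
      simpa [hp', c] using this
    · intro h
      refine LinearMap.ext fun x => ?_
      have := LinearMap.congr_fun h (e x)
      simpa [hp', c] using this
  have h1 : IsUnit (c h) ↔ IsUnit h := MulEquiv.isUnit_map c
  have h2 : Commute (c h) (c X) ↔ Commute h X := by
    rw [commute_iff_eq, commute_iff_eq, ← map_mul, ← map_mul, c.injective.eq_iff]
  have h3 : IsNilpotent (c X) ↔ IsNilpotent X := IsNilpotent.map_iff c.injective
  have hh := hc h g
  have hX := hc X R
  change _ ↔ (c h, c X) ∈ lifts (LinearMap.snd K L N) g R
  simp only [lifts, nilPairs, intertwiners, Set.mem_ofPred_eq, h1, h2, h3, Submodule.mem_mk,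
    AddSubmonoid.mem_mk, AddSubsemigroup.mem_mk, hh, hX]

/-- Isomorphisms Z ≅ L × N fibre over the surjections Z → N, and each fibre is a torsor under the
matrices (S, f; 0, 1) with S invertible. -/
theorem natCard_surjective_mul [Finite Z]
    (hd : Module.finrank K Z = Module.finrank K L + Module.finrank K N) :
    Nat.card {p : Z →ₗ[K] N // Function.Surjective p} *
      (Nat.card (Module.End K L)ˣ * Nat.card (N →ₗ[K] L)) = Nat.card (Module.End K Z)ˣ := by
  have hd' : Module.finrank K Z = Module.finrank K (L × N) := by rw [Module.finrank_prod, hd]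
  have e₀ := LinearEquiv.ofFinrankEq Z (L × N) hd'
  let F := {f : Z →ₗ[K] L × N // Function.Bijective f}
  have hF : Nat.card F = Nat.card (Module.End K Z)ˣ := by
    rw [natCard_units]
    refine Nat.card_congr ((e₀.symm.congrRight).toEquiv.subtypeEquiv fun f => ?_)
    rw [Module.End.isUnit_iff]
    exact (e₀.symm.toEquiv.comp_bijective f).symm
  let π : F → {p : Z →ₗ[K] N // Function.Surjective p} := fun f =>
    ⟨LinearMap.snd K L N ∘ₗ f.1, Prod.snd_surjective.comp f.2.2⟩
  rw [← hF]
  refine (natCard_eq_mul_of_fiber π _ fun p => ?_).symm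
  obtain ⟨e, he⟩ := exists_equiv_prod_of_surjective (L := L) p.1 p.2 hd
  rw [natCard_units, ← Nat.card_prod]
  symm
  have hbij : ∀ x : {S : Module.End K L // IsUnit S} × (N →ₗ[K] L),
      Function.Bijective (block x.1.1 x.2 (1 : Module.End K N) ∘ₗ (e : Z →ₗ[K] L × N)) := fun x =>
    ((Module.End.isUnit_iff _).1 ((isUnit_block x.1.1 x.2 1).2 ⟨x.1.2, isUnit_one⟩)).comp
      e.bijective
  refine Nat.card_congr (Equiv.ofBijective (fun x => ⟨⟨_, hbij x⟩, Subtype.ext he⟩) ⟨?_, ?_⟩)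
  · rintro ⟨⟨S, hS⟩, f⟩ ⟨⟨S', hS'⟩, f'⟩ h
    have h1 : block S f 1 ∘ₗ (e : Z →ₗ[K] L × N) = block S' f' 1 ∘ₗ (e : Z →ₗ[K] L × N) :=
      congrArg (fun y => y.1.1) h
    have h2 : block S f (1 : Module.End K N) = block S' f' 1 := LinearMap.ext fun y => by
      simpa using LinearMap.congr_fun h1 (e.symm y)
    obtain ⟨rfl, rfl, -⟩ := block_injective h2
    rfl
  · rintro ⟨⟨f, hf⟩, hfp⟩
    have hfp' : ∀ z, (f z).2 = p.1 z := fun z => LinearMap.congr_fun (congrArg Subtype.val hfp) z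
    have hep : ∀ z, (e z).2 = p.1 z := fun z => LinearMap.congr_fun he z
    obtain ⟨S, a, hSa⟩ := (snd_comp_eq_iff (f ∘ₗ (e.symm : L × N →ₗ[K] Z)) 1).1 (by
      refine LinearMap.ext fun x => ?_
      simp [hfp', ← hep])
    have hS : IsUnit S := by
      refine ((isUnit_block S a 1).1 ?_).1
      rw [← hSa, Module.End.isUnit_iff]
      exact hf.comp e.symm.bijective
    refine ⟨⟨⟨S, hS⟩, a⟩, Subtype.ext (Subtype.ext ?_)⟩
    simp only [← hSa]
    exact LinearMap.ext fun z => by simp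

end Lifts

/-! ### The generating function and its recursion over stable submodules -/

section Recursion

variable {K V W : Type*} [Field K] [AddCommGroup V] [Module K V] [AddCommGroup W] [Module K W]

theorem mem_intertwiners {h S : Module.End K V} {g R : Module.End K W} {φ : V →ₗ[K] W} :
    φ ∈ intertwiners h S g R ↔ φ ∘ₗ h = g ∘ₗ φ ∧ φ ∘ₗ S = R ∘ₗ φ := Iff.rfl

/-- The submodules of `N` that are stable under `g` and `R`. -/
noncomputable def stableBelow [Finite W] (g R : Module.End K W) (N : Submodule K W) :
    Finset (Submodule K W) :=
  (Set.toFinite {N' | N' ≤ N ∧ N'.map g ≤ N' ∧ N'.map R ≤ N'}).toFinset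

theorem mem_stableBelow [Finite W] {g R : Module.End K W} {N N' : Submodule K W} :
    N' ∈ stableBelow g R N ↔ N' ≤ N ∧ N'.map g ≤ N' ∧ N'.map R ≤ N' := by
  simp [stableBelow]

theorem map_range_le_of_comp_eq {φ : V →ₗ[K] W} {h : Module.End K V} {g : Module.End K W}
    (e : φ ∘ₗ h = g ∘ₗ φ) : (LinearMap.range φ).map g ≤ LinearMap.range φ := by
  rw [← LinearMap.range_comp, ← e]
  exact LinearMap.range_comp_le_range h φ

theorem restrict_mem_nilPairs [Finite W] {g R : Module.End K W} (hgR : (g, R) ∈ nilPairs K W)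
    {N : Submodule K W} (hg : ∀ x ∈ N, g x ∈ N) (hR : ∀ x ∈ N, R x ∈ N) :
    (g.restrict hg, R.restrict hR) ∈ nilPairs K N := by
  refine ⟨?_, ?_, ?_⟩
  · rw [LinearMap.isUnit_iff_ker_eq_bot, LinearMap.ker_eq_bot']
    intro x hx
    have h1 : g x = 0 := congrArg Subtype.val hx
    have h2 := ((Module.End.isUnit_iff _).1 hgR.1).1 (h1.trans (map_zero g).symm)
    exact Subtype.ext h2
  · exact LinearMap.ext fun x => Subtype.ext (LinearMap.congr_fun hgR.2.1.eq (x : W))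
  · exact Module.End.isNilpotent.restrict hR hgR.2.2

theorem subtype_comp_mem_intertwiners_iff {g R : Module.End K W} {N : Submodule K W}
    (hg : ∀ x ∈ N, g x ∈ N) (hR : ∀ x ∈ N, R x ∈ N) (h S : Module.End K V) (φ : V →ₗ[K] N) :
    N.subtype ∘ₗ φ ∈ intertwiners h S g R ↔
      φ ∈ intertwiners h S (g.restrict hg) (R.restrict hR) := by
  have key : ∀ (a : Module.End K V) (b : Module.End K W) (hb : ∀ x ∈ N, b x ∈ N),
      (N.subtype ∘ₗ φ) ∘ₗ a = b ∘ₗ N.subtype ∘ₗ φ ↔ φ ∘ₗ a = b.restrict hb ∘ₗ φ := by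
    intro a b hb
    simp only [LinearMap.ext_iff, Subtype.ext_iff]
    rfl
  rw [mem_intertwiners, mem_intertwiners, key h g hg, key S R hR]

theorem natCard_nilHoms_restrict {g R : Module.End K W} {N : Submodule K W}
    (hg : ∀ x ∈ N, g x ∈ N) (hR : ∀ x ∈ N, R x ∈ N) :
    Nat.card (nilHoms V (g.restrict hg) (R.restrict hR) ⊤) = Nat.card (nilHoms V g R N) := by
  refine Nat.card_congr (Equiv.ofBijective (fun x => ⟨(x.1.1, N.subtype ∘ₗ x.1.2), x.2.1,
    (subtype_comp_mem_intertwiners_iff hg hR _ _ _).2 x.2.2.1, ?_⟩) ⟨?_, ?_⟩)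
  · exact (LinearMap.range_comp_le_range _ _).trans (Submodule.range_subtype N).le
  · rintro ⟨⟨y, φ⟩, hx⟩ ⟨⟨y', φ'⟩, hx'⟩ e
    have e1 : y = y' := congrArg (fun z => z.1.1) e
    have e2 : N.subtype ∘ₗ φ = N.subtype ∘ₗ φ' := congrArg (fun z => z.1.2) e
    have e3 : φ = φ' := LinearMap.ext fun v => Subtype.ext (LinearMap.congr_fun e2 v)
    subst e1 e3
    rfl
  · rintro ⟨⟨y, φ⟩, h1, h2, h3⟩
    let ψ := φ.codRestrict N fun v => h3 ⟨v, rfl⟩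
    have hψ : N.subtype ∘ₗ ψ = φ := LinearMap.ext fun v => rfl
    exact ⟨⟨(y, ψ), h1, (subtype_comp_mem_intertwiners_iff hg hR _ _ _).1 (hψ ▸ h2), le_top⟩, rfl⟩

theorem natCard_nilHoms_range_eq_sum [Finite V] [Finite W] {g R : Module.End K W}
    {N : Submodule K W} (hg : ∀ x ∈ N, g x ∈ N) (hR : ∀ x ∈ N, R x ∈ N)
    [Fintype {p : V →ₗ[K] N // Function.Surjective p}] :
    Nat.card {x : (Module.End K V × Module.End K V) × (V →ₗ[K] W) //
      x.1 ∈ nilPairs K V ∧ x.2 ∈ intertwiners x.1.1 x.1.2 g R ∧ LinearMap.range x.2 = N} =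
    ∑ p : {p : V →ₗ[K] N // Function.Surjective p},
      Nat.card (lifts p.1 (g.restrict hg) (R.restrict hR)) := by
  rw [← Nat.card_sigma]
  symm
  refine Nat.card_congr (Equiv.ofBijective (fun x => ⟨(x.2.1, N.subtype ∘ₗ x.1.1), x.2.2.1,
    (subtype_comp_mem_intertwiners_iff hg hR _ _ _).2 x.2.2.2, ?_⟩) ⟨?_, ?_⟩)
  · rw [LinearMap.range_comp, LinearMap.range_eq_top.2 x.1.2, Submodule.map_top,
      Submodule.range_subtype]
  · rintro ⟨⟨φ, hφ⟩, y, hy⟩ ⟨⟨φ', hφ'⟩, y', hy'⟩ e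
    have e1 : y = y' := congrArg (fun z => z.1.1) e
    have e2 : N.subtype ∘ₗ φ = N.subtype ∘ₗ φ' := congrArg (fun z => z.1.2) e
    have e3 : φ = φ' := LinearMap.ext fun v => Subtype.ext (LinearMap.congr_fun e2 v)
    subst e1 e3
    rfl
  · rintro ⟨⟨y, φ⟩, h1, h2, h3⟩
    simp only at h1 h2 h3
    let ψ := φ.codRestrict N fun v => h3 ▸ ⟨v, rfl⟩
    have hψ : N.subtype ∘ₗ ψ = φ := LinearMap.ext fun v => rfl
    have hs : Function.Surjective ψ := by
      rintro ⟨n, hn⟩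
      rw [← h3] at hn
      obtain ⟨v, hv⟩ := hn
      exact ⟨v, Subtype.ext hv⟩
    exact ⟨⟨⟨ψ, hs⟩, y, h1, (subtype_comp_mem_intertwiners_iff hg hR _ _ _).1 (hψ ▸ h2)⟩, rfl⟩

/-- L plays the kernel of a surjection V → N. All surjections have equally many lifts, and their
number is |GL(V)| / (|GL(L)| |Hom(N, L)|). The remaining ratio of group orders is what the
denominators of `nilSeries` absorb. -/
theorem natCard_nilHoms_range_eq_mul {L : Type*} [AddCommGroup L] [Module K L] [Finite L]
    [Finite V] [Finite W] {g R : Module.End K W} (hgR : (g, R) ∈ nilPairs K W)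
    {N : Submodule K W} (hg : N.map g ≤ N) (hR : N.map R ≤ N)
    (hd : Module.finrank K V = Module.finrank K L + Module.finrank K N) :
    Nat.card {x : (Module.End K V × Module.End K V) × (V →ₗ[K] W) //
      x.1 ∈ nilPairs K V ∧ x.2 ∈ intertwiners x.1.1 x.1.2 g R ∧ LinearMap.range x.2 = N} *
      Nat.card (Module.End K L)ˣ = Nat.card (Module.End K V)ˣ * Nat.card (nilHoms L g R N) := by
  cases nonempty_fintype {p : V →ₗ[K] N // Function.Surjective p}
  have hg' : ∀ x ∈ N, g x ∈ N := fun x hx => hg ⟨x, hx, rfl⟩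
  have hR' : ∀ x ∈ N, R x ∈ N := fun x hx => hR ⟨x, hx, rfl⟩
  rw [natCard_nilHoms_range_eq_sum hg' hR', Finset.sum_congr rfl fun p _ =>
    natCard_lifts (L := L) p.1 p.2 hd _ _ (restrict_mem_nilPairs hgR hg' hR'),
    natCard_nilHoms_restrict hg' hR', Finset.sum_const, Finset.card_univ,
    ← Nat.card_eq_fintype_card, ← natCard_surjective_mul (L := L) (N := N) hd, smul_eq_mul]
  ring

/-- The generating function of the numbers of elements of `nilHoms (Kʲ) g R N`, divided by the
order of `GL_j(K)`. -/
noncomputable def nilSeries (g R : Module.End K W) (N : Submodule K W) : PowerSeries ℚ :=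
  PowerSeries.mk fun j => (Nat.card (nilHoms (Fin j → K) g R N) : ℚ) /
    Nat.card (Module.End K (Fin j → K))ˣ

/-- The range of an intertwiner is stable, so homomorphisms can be sorted by range N'. The kernel
then has dimension j - dim N', whence the shift by `X ^ dim N'`. -/
theorem nilSeries_eq_sum [Finite K] [Finite W] {g R : Module.End K W}
    (hgR : (g, R) ∈ nilPairs K W) (N : Submodule K W) :
    nilSeries g R N = ∑ N' ∈ stableBelow g R N,
      PowerSeries.X ^ Module.finrank K N' * nilSeries g R N' := by
  ext j
  cases nonempty_fintype (Submodule K W)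
  have h0 : ∀ i, (Nat.card (Module.End K (Fin i → K))ˣ : ℚ) ≠ 0 := fun i =>
    Nat.cast_ne_zero.2 Nat.card_pos.ne'
  have h1 := natCard_eq_sum_fiber fun x : nilHoms (Fin j → K) g R N => LinearMap.range x.1.2
  rw [map_sum, nilSeries, PowerSeries.coeff_mk, h1, Nat.cast_sum, Finset.sum_div]
  symm
  apply Finset.sum_subset_zero_on_sdiff (Finset.subset_univ _)
  · intro N' hN'
    have : IsEmpty {x : nilHoms (Fin j → K) g R N // LinearMap.range x.1.2 = N'} := by
      refine ⟨fun x => (Finset.mem_sdiff.1 hN').2 ?_⟩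
      obtain ⟨⟨⟨y, φ⟩, h1, h2, h3⟩, rfl⟩ := x
      exact mem_stableBelow.2 ⟨h3, map_range_le_of_comp_eq h2.1, map_range_le_of_comp_eq h2.2⟩
    simp
  · intro N' hN'
    obtain ⟨hle, hg, hR⟩ := mem_stableBelow.1 hN'
    have e : Nat.card {x : nilHoms (Fin j → K) g R N // LinearMap.range x.1.2 = N'} =
        Nat.card {x : (Module.End K (Fin j → K) × Module.End K (Fin j → K)) ×
          ((Fin j → K) →ₗ[K] W) // x.1 ∈ nilPairs K (Fin j → K) ∧
            x.2 ∈ intertwiners x.1.1 x.1.2 g R ∧ LinearMap.range x.2 = N'} :=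
      Nat.card_congr
        { toFun := fun x => ⟨x.1.1, x.1.2.1, x.1.2.2.1, x.2⟩
          invFun := fun x => ⟨⟨x.1, x.2.1, x.2.2.1, x.2.2.2.le.trans hle⟩, x.2.2.2⟩
          left_inv := fun x => rfl
          right_inv := fun x => rfl }
    rw [PowerSeries.coeff_X_pow_mul', e]
    split_ifs with hd
    · have := natCard_nilHoms_range_eq_mul (L := Fin (j - Module.finrank K N') → K)
        (V := Fin j → K) hgR hg hR (by simp; omega)
      rw [nilSeries, PowerSeries.coeff_mk, div_eq_div_iff (h0 _) (h0 _)]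
      rw [mul_comm (Nat.card (Module.End K (Fin j → K))ˣ)] at this
      exact_mod_cast this.symm
    · have : IsEmpty {x : (Module.End K (Fin j → K) × Module.End K (Fin j → K)) ×
          ((Fin j → K) →ₗ[K] W) // x.1 ∈ nilPairs K (Fin j → K) ∧
            x.2 ∈ intertwiners x.1.1 x.1.2 g R ∧ LinearMap.range x.2 = N'} := by
        refine ⟨fun x => hd ?_⟩
        rw [← x.2.2.2]
        simpa using LinearMap.finrank_range_le x.1.2
      simp

end Recursion

/-! ### Stable flags and evaluation at 1 -/

section Flags

variable {K W : Type*} [Field K] [AddCommGroup W] [Module K W] [Finite W]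

/-- The flags of submodules of `N` of dimensions `s, s - 1, …, 1` that are stable under `g`
and `R`. -/
def stableFlags (g R : Module.End K W) (N : Submodule K W) (s : ℕ) :
    Set (Fin s → Submodule K W) :=
  {F | Antitone F ∧ ∀ i, Module.finrank K (F i) = s - i ∧ F i ∈ stableBelow g R N}

theorem natCard_stableFlags_zero (g R : Module.End K W) (N : Submodule K W) :
    Nat.card (stableFlags g R N 0) = 1 := by
  have : stableFlags g R N 0 = Set.univ :=
    Set.eq_univ_of_forall fun F => ⟨fun i => i.elim0, fun i => i.elim0⟩
  rw [this]
  simp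

theorem cons_mem_stableFlags {g R : Module.End K W} {N N' : Submodule K W} {s : ℕ}
    {F : Fin s → Submodule K W} :
    (Fin.cons N' F : Fin (s + 1) → Submodule K W) ∈ stableFlags g R N (s + 1) ↔
      N' ∈ stableBelow g R N ∧ Module.finrank K N' = s + 1 ∧ F ∈ stableFlags g R N' s := by
  constructor
  · rintro ⟨h1, h2⟩
    refine ⟨(h2 0).2, (h2 0).1, fun i j hij => ?_, fun i => ⟨?_, ?_⟩⟩
    · simpa using h1 (Fin.succ_le_succ_iff.2 hij)
    · exact (h2 i.succ).1.trans (by simp)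
    · refine mem_stableBelow.2 ⟨?_, (mem_stableBelow.1 (h2 i.succ).2).2⟩
      simpa using h1 (Fin.zero_le i.succ)
  · rintro ⟨h1, h2, h3, h4⟩
    refine ⟨fun i j => ?_, fun i => ?_⟩
    · refine Fin.cases ?_ (fun j' => ?_) j <;>
        refine Fin.cases ?_ (fun i' => ?_) i
      · exact fun _ => le_rfl
      · exact fun h => absurd h (by simp)
      · exact fun _ => (mem_stableBelow.1 (h4 j').2).1
      · intro hij
        exact h3 (Fin.succ_le_succ_iff.1 hij)
    · refine Fin.cases ⟨h2, h1⟩ (fun i' => ⟨?_, mem_stableBelow.2 ⟨?_, ?_⟩⟩) i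
      · exact (h4 i').1.trans (by simp)
      · exact (mem_stableBelow.1 (h4 i').2).1.trans (mem_stableBelow.1 h1).1
      · exact (mem_stableBelow.1 (h4 i').2).2

theorem natCard_stableFlags_succ (g R : Module.End K W) (N : Submodule K W) (s : ℕ) :
    Nat.card (stableFlags g R N (s + 1)) =
      ∑ N' ∈ (stableBelow g R N).filter (fun N' : Submodule K W => Module.finrank K N' = s + 1),
        Nat.card (stableFlags g R N' s) := by
  cases nonempty_fintype (Submodule K W)
  rw [natCard_eq_sum_fiber fun F : stableFlags g R N (s + 1) => F.1 0]
  symm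
  apply Finset.sum_subset_zero_on_sdiff (Finset.subset_univ _)
  · intro N' hN'
    have : IsEmpty {F : stableFlags g R N (s + 1) // F.1 0 = N'} := by
      refine ⟨fun x => (Finset.mem_sdiff.1 hN').2 ?_⟩
      obtain ⟨⟨F, h1, h2⟩, rfl⟩ := x
      exact Finset.mem_filter.2 ⟨(h2 0).2, (h2 0).1⟩
    simp
  · intro N' hN'
    obtain ⟨h1, h2⟩ := Finset.mem_filter.1 hN'
    refine Nat.card_congr (Equiv.ofBijective (fun F => ⟨⟨Fin.cons N' F.1,
      cons_mem_stableFlags.2 ⟨h1, h2, F.2⟩⟩, rfl⟩) ⟨?_, ?_⟩)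
    · intro F F' e
      have e1 : (Fin.cons N' F.1 : Fin (s + 1) → Submodule K W) = Fin.cons N' F'.1 :=
        congrArg (fun x => x.1.1) e
      exact Subtype.ext (Fin.cons_right_injective _ e1)
    · rintro ⟨⟨F, hF⟩, rfl⟩
      refine ⟨⟨Fin.tail F, ?_⟩, ?_⟩
      · rw [← Fin.cons_self_tail F] at hF
        exact (cons_mem_stableFlags.1 hF).2.2
      · exact Subtype.ext (Subtype.ext (Fin.cons_self_tail F))

-- Moving the term N' = N of `nilSeries_eq_sum` to the left produces the factor 1 - X^d. A proper N'
-- of dimension d' contributes X^d' ∏ (1 - X^i) P_N', the product over d' < i < d. At 1 this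
-- vanishes unless d' = d - 1, which is the recursion of flags by their largest member.
open Polynomial in
theorem exists_polynomial_eval_one_eq_natCard_stableFlags [Finite K] {g R : Module.End K W}
    (hgR : (g, R) ∈ nilPairs K W) (d : ℕ) :
    ∀ N : Submodule K W, N ∈ stableBelow g R N → Module.finrank K N = d →
      ∃ P : ℚ[X], P.natDegree ≤ ∑ i ∈ Finset.range d, i ∧
        (∏ i ∈ Finset.range d, (1 - PowerSeries.X ^ (i + 1))) * nilSeries g R N =
          P * nilSeries g R ⊥ ∧
        P.eval 1 = Nat.card (stableFlags g R N (d - 1)) := by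
  induction d using Nat.strong_induction_on with
  | _ d ih =>
    intro N hN hd
    rcases d with _ | e
    · have : N = ⊥ := Submodule.finrank_eq_zero.1 hd
      subst this
      -- Here `d - 1` truncates to 0, and the empty flag is the only one.
      exact ⟨1, by simp, by simp, by rw [natCard_stableFlags_zero]; simp⟩
    · have ih' : ∀ N' : Submodule K W, ∃ P : ℚ[X], N' ∈ (stableBelow g R N).erase N →
          P.natDegree ≤ ∑ i ∈ Finset.range (Module.finrank K N'), i ∧
          (∏ i ∈ Finset.range (Module.finrank K N'), (1 - PowerSeries.X ^ (i + 1))) *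
            nilSeries g R N' = P * nilSeries g R ⊥ ∧
          P.eval 1 = Nat.card (stableFlags g R N' (Module.finrank K N' - 1)) ∧
          Module.finrank K N' ≤ e := by
        intro N'
        by_cases h : N' ∈ (stableBelow g R N).erase N
        · obtain ⟨hne, h1, h2⟩ := (Finset.mem_erase.trans (and_congr_right fun _ =>
            mem_stableBelow)).1 h
          have hlt := Submodule.finrank_lt_finrank_of_lt (lt_of_le_of_ne h1 hne)
          obtain ⟨P, h3, h4, h5⟩ := ih _ (hd ▸ hlt) N' (mem_stableBelow.2 ⟨le_rfl, h2⟩) rfl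
          exact ⟨P, fun _ => ⟨h3, h4, h5, by omega⟩⟩
        · exact ⟨0, fun h' => absurd h' h⟩
      choose P hP using ih'
      let Q : Submodule K W → ℚ[X] := fun N' => X ^ Module.finrank K N' *
        (∏ i ∈ Finset.Ico (Module.finrank K N') e, (1 - X ^ (i + 1))) * P N'
      refine ⟨∑ N' ∈ (stableBelow g R N).erase N, Q N', ?_, ?_, ?_⟩
      · refine natDegree_sum_le_of_forall_le _ _ fun N' hN' => ?_
        obtain ⟨h1, -, -, h4⟩ := hP N' hN'
        have h5 : (∏ i ∈ Finset.Ico (Module.finrank K N') e,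
            (1 - X ^ (i + 1) : ℚ[X])).natDegree ≤
            ∑ i ∈ Finset.Ico (Module.finrank K N') e, (i + 1) := by
          refine (natDegree_prod_le _ _).trans (Finset.sum_le_sum fun i _ => ?_)
          refine (natDegree_sub_le _ _).trans ?_
          simp
        have h6 : ∑ i ∈ Finset.Ico (Module.finrank K N') e, (i + 1) =
            ∑ i ∈ Finset.Ico (Module.finrank K N' + 1) (e + 1), i :=
          Finset.sum_Ico_add' (fun i => i) _ _ 1
        have h7 := Finset.sum_range_add_sum_Ico (fun i => i) (Nat.succ_le_succ h4)
        rw [Finset.sum_range_succ] at h7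
        -- The degrees add up exactly: d' + ∑_{d' < i ≤ e} i + ∑_{i < d'} i = ∑_{i ≤ e} i.
        refine natDegree_mul_le.trans ?_
        refine (add_le_add_left natDegree_mul_le _).trans ?_
        rw [natDegree_X_pow]
        simp only [Nat.succ_eq_add_one] at h7
        omega
      · have h1 := nilSeries_eq_sum hgR N
        rw [← Finset.add_sum_erase _ _ hN, hd] at h1
        have h2 : (1 - PowerSeries.X ^ (e + 1)) * nilSeries g R N =
            ∑ N' ∈ (stableBelow g R N).erase N,
              PowerSeries.X ^ Module.finrank K N' * nilSeries g R N' := by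
          linear_combination h1
        rw [Finset.prod_range_succ, mul_assoc, h2, Finset.mul_sum]
        have hc : ((∑ N' ∈ (stableBelow g R N).erase N, Q N' : ℚ[X]) : PowerSeries ℚ) =
            ∑ N' ∈ (stableBelow g R N).erase N, (Q N' : PowerSeries ℚ) :=
          map_sum (Polynomial.coeToPowerSeries.ringHom (R := ℚ)) _ _
        rw [hc, Finset.sum_mul]
        refine Finset.sum_congr rfl fun N' hN' => ?_
        obtain ⟨-, h3, -, h4⟩ := hP N' hN'
        have hq : ((∏ i ∈ Finset.Ico (Module.finrank K N') e, (1 - X ^ (i + 1)) : ℚ[X]) :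
            PowerSeries ℚ) =
            ∏ i ∈ Finset.Ico (Module.finrank K N') e, (1 - PowerSeries.X ^ (i + 1)) := by
          rw [← Polynomial.coeToPowerSeries.ringHom_apply, map_prod]
          simp
        rw [← Finset.prod_range_mul_prod_Ico _ h4]
        simp only [Q, Polynomial.coe_mul, Polynomial.coe_pow, Polynomial.coe_X, hq]
        linear_combination (PowerSeries.X ^ Module.finrank K N' *
          ∏ i ∈ Finset.Ico (Module.finrank K N') e, (1 - PowerSeries.X ^ (i + 1))) * h3
      · rw [eval_finsetSum]
        have hQ : ∀ N' ∈ (stableBelow g R N).erase N, (Q N').eval 1 =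
            if Module.finrank K N' = e then (Nat.card (stableFlags g R N' (e - 1)) : ℚ) else 0 := by
          intro N' hN'
          obtain ⟨-, -, h3, h4⟩ := hP N' hN'
          simp only [Q, eval_mul, eval_pow, eval_X, one_pow, one_mul, eval_prod, eval_sub, eval_one,
            sub_self, Finset.prod_const, Nat.card_Ico, h3]
          split_ifs with h
          · rw [h, Nat.sub_self, pow_zero, one_mul]
          · rw [zero_pow (by omega), zero_mul]
        rw [Finset.sum_congr rfl hQ, ← Finset.sum_filter, Nat.add_sub_cancel]
        -- A line has ⊥ as its only hyperplane, and ⊥ is not a member of the flag, so this case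
        -- escapes `natCard_stableFlags_succ`.
        rcases e with _ | s
        · have : ((stableBelow g R N).erase N).filter (fun N' : Submodule K W => Module.finrank K N' = 0) =
            {⊥} := by
            ext N'
            simp only [Finset.mem_filter, Finset.mem_erase, mem_stableBelow, Finset.mem_singleton,
              Submodule.finrank_eq_zero]
            constructor
            · exact fun h => h.2
            · rintro rfl
              refine ⟨⟨?_, by simp⟩, rfl⟩
              rintro rfl
              simp at hd
          rw [this, Finset.sum_singleton, natCard_stableFlags_zero, natCard_stableFlags_zero]
        · rw [natCard_stableFlags_succ, Nat.cast_sum]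
          refine Finset.sum_congr (Finset.ext fun N' => ?_) fun _ _ => rfl
          simp only [Finset.mem_filter, Finset.mem_erase]
          constructor
          · exact fun h => ⟨h.1.2, h.2⟩
          · refine fun h => ⟨⟨?_, h.1⟩, h.2⟩
            rintro rfl
            omega

end Flags

/-! ### Cauchy–Frobenius, and flag orbits as a sum over commuting pairs -/

/-- The Cauchy–Frobenius lemma for `orbitCount`. -/
theorem orbitCount_mul_natCard {M X : Type*} [Group M] [Finite M] [Finite X]
    (ρ : M →* Equiv.Perm X) (G : Subgroup M) (S : Set X) (hS : ∀ g ∈ G, ∀ x ∈ S, ρ g x ∈ S) :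
    orbitCount ρ G S * Nat.card G =
      Nat.card {x : M × X // x.1 ∈ G ∧ x.2 ∈ S ∧ ρ x.1 x.2 = x.2} := by
  classical
  let act : MulAction G S :=
    { smul := fun g x => ⟨ρ g x, hS g g.2 x x.2⟩
      one_smul := fun x => Subtype.ext (by change ρ (1 : G) x = x; simp)
      mul_smul := fun g h x => Subtype.ext (by
        change ρ ((g * h : G) : M) x = ρ g (ρ h x); simp) }
  have hsmul : ∀ (g : G) (x : S), ((g • x : S) : X) = ρ g x := fun g x => rfl
  -- `orbitCount` is the number of values of `f`, and the fibres of `f` are the orbits.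
  let f : S → Set X := fun x => {y : X | ∃ g ∈ G, ρ g x = y}
  have hrel : MulAction.orbitRel G S = Setoid.ker f := by
    ext x y
    rw [MulAction.orbitRel_apply, Setoid.ker_def]
    constructor
    · rintro ⟨g, rfl⟩
      ext z
      constructor
      · rintro ⟨k, hk, rfl⟩
        exact ⟨k * g, G.mul_mem hk g.2, by simp [hsmul]⟩
      · rintro ⟨k, hk, rfl⟩
        exact ⟨k * (g : M)⁻¹, G.mul_mem hk (G.inv_mem g.2), by simp [hsmul]⟩
    · intro h
      have hx : (x : X) ∈ f x := ⟨1, G.one_mem, by simp⟩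
      rw [h] at hx
      obtain ⟨g, hg, hgx⟩ := hx
      exact ⟨⟨g, hg⟩, Subtype.ext hgx⟩
  have horb : orbitCount ρ G S = Nat.card (Quotient (MulAction.orbitRel G S)) := by
    rw [hrel, Nat.card_congr (Setoid.quotientKerEquivRange f), orbitCount, Set.image_eq_range]
    rfl
  cases nonempty_fintype G
  cases nonempty_fintype S
  have hb := MulAction.sum_card_fixedBy_eq_card_orbits_mul_card_group G S
  simp only [← Nat.card_eq_fintype_card] at hb
  rw [horb, ← hb, ← Nat.card_sigma]
  refine Nat.card_congr
    { toFun := fun x => ⟨(x.1, x.2.1), x.1.2, x.2.1.2, congrArg Subtype.val x.2.2⟩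
      invFun := fun x => ⟨⟨x.1.1, x.2.1⟩, ⟨⟨x.1.2, x.2.2.1⟩, Subtype.ext x.2.2.2⟩⟩
      left_inv := fun x => rfl
      right_inv := fun x => rfl }

theorem conjAction_apply {R : Type*} [Ring R] (g : Rˣ) (x : R) :
    conjAction R g x = (g : R) * x * ((g⁻¹ : Rˣ) : R) := rfl

theorem conjAction_eq_self_iff {R : Type*} [Ring R] (g : Rˣ) (x : R) :
    conjAction R g x = x ↔ Commute (g : R) x := by
  rw [conjAction_apply, Units.mul_inv_eq_iff_eq_mul]
  rfl

section Counting

variable {K W : Type*} [Field K] [AddCommGroup W] [Module K W]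

/-- The pairs of commuting elements of `G` and `A`. -/
def commutingPairs (G : Subgroup (Module.End K W)ˣ) (A : Set (Module.End K W)) :
    Set ((Module.End K W)ˣ × Module.End K W) :=
  {x | x.1 ∈ G ∧ x.2 ∈ A ∧ Commute (x.1 : Module.End K W) x.2}

variable {G : Subgroup (Module.End K W)ˣ} {A : Set (Module.End K W)}

theorem flagAction_mem_flagPairs {s : ℕ} {l : Fin s → ℕ}
    (hGA : ∀ g ∈ G, ∀ X ∈ A,
      (g : Module.End K W) * X * ((g⁻¹ : (Module.End K W)ˣ) : Module.End K W) ∈ A) :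
    ∀ g ∈ G, ∀ x ∈ flagPairs l A, flagAction K W s g x ∈ flagPairs l A := by
  rintro g hg ⟨F, R⟩ ⟨h1, h2, h3, h4⟩
  refine ⟨fun i j hij => Submodule.map_mono (h1 hij), fun i => ?_, hGA g hg R h3, fun i => ?_⟩
  · rw [← h2 i]
    exact (Submodule.equivMapOfInjective _
      ((Module.End.isUnit_iff _).1 g.isUnit).1 (F i)).finrank_eq.symm
  · change ((F i).map (g : Module.End K W)).map ((g : Module.End K W) * R *
      ((g⁻¹ : (Module.End K W)ˣ) : Module.End K W)) ≤ (F i).map (g : Module.End K W)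
    rw [← Submodule.map_comp, ← Module.End.mul_eq_comp, mul_assoc, Units.inv_mul, mul_one,
      Module.End.mul_eq_comp, Submodule.map_comp]
    exact Submodule.map_mono (h4 i)

variable [Finite W]

/-- Being fixed by g means equality, while `stableBelow` asks only for an inclusion; dimensions
reconcile them. -/
theorem map_unit_eq_iff (g : (Module.End K W)ˣ) (N : Submodule K W) :
    N.map (g : Module.End K W) = N ↔ N.map (g : Module.End K W) ≤ N := by
  refine ⟨fun h => h.le, fun h => Submodule.eq_of_le_of_finrank_eq h ?_⟩
  exact (Submodule.equivMapOfInjective _ ((Module.End.isUnit_iff _).1 g.isUnit).1 N).finrank_eq.symm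

theorem xi_staircase_mul_natCard [Fintype (commutingPairs G A)] (m : ℕ)
    (hGA : ∀ g ∈ G, ∀ X ∈ A,
      (g : Module.End K W) * X * ((g⁻¹ : (Module.End K W)ˣ) : Module.End K W) ∈ A) :
    xi (staircase m) G A * Nat.card G = ∑ x : commutingPairs G A,
      Nat.card (stableFlags (x.1.1 : Module.End K W) x.1.2 ⊤ (m - 1)) := by
  rw [xi, orbitCount_mul_natCard _ _ _ (flagAction_mem_flagPairs hGA), ← Nat.card_sigma]
  have key : ∀ (g : (Module.End K W)ˣ) (F : Fin (m - 1) → Submodule K W) (R : Module.End K W),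
      (g ∈ G ∧ (F, R) ∈ flagPairs (staircase m) A ∧ flagAction K W (m - 1) g (F, R) = (F, R)) ↔
        (g, R) ∈ commutingPairs G A ∧
          F ∈ stableFlags (g : Module.End K W) R ⊤ (m - 1) := by
    intro g F R
    have e : flagAction K W (m - 1) g (F, R) = (F, R) ↔
        (∀ i, (F i).map (g : Module.End K W) ≤ F i) ∧ Commute (g : Module.End K W) R := by
      rw [← conjAction_eq_self_iff]
      simp only [← map_unit_eq_iff]
      exact Prod.ext_iff.trans (and_congr funext_iff Iff.rfl)
    rw [e]
    constructor
    · rintro ⟨h1, ⟨h2, h3, h4, h5⟩, h6, h7⟩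
      exact ⟨⟨h1, h4, h7⟩, h2, fun i => ⟨h3 i, mem_stableBelow.2 ⟨le_top, h6 i, h5 i⟩⟩⟩
    · rintro ⟨⟨h1, h4, h7⟩, h2, h3⟩
      exact ⟨h1, ⟨h2, fun i => (h3 i).1, h4, fun i => (mem_stableBelow.1 (h3 i).2).2.2⟩,
        fun i => (mem_stableBelow.1 (h3 i).2).2.1, h7⟩
  refine Nat.card_congr
    { toFun := fun x => ⟨⟨(x.1.1, x.1.2.2), ((key _ _ _).1 x.2).1⟩, x.1.2.1,
        ((key _ _ _).1 x.2).2⟩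
      invFun := fun x => ⟨(x.1.1.1, x.2.1, x.1.1.2), (key _ _ _).2 ⟨x.1.2, x.2.2⟩⟩
      left_inv := fun x => rfl
      right_inv := fun x => rfl }

end Counting

/-! ### Orbits on lifts as a sum over commuting pairs -/

section BlockRing

variable {K V W : Type*} [Field K] [AddCommGroup V] [Module K V] [AddCommGroup W] [Module K W]

/-- The endomorphism ring of the split sequence `V → V × W → W`. -/
abbrev SplitEnd (K V W : Type*) [Field K] [AddCommGroup V] [Module K V] [AddCommGroup W]
    [Module K W] : Type _ :=
  endRing (LinearMap.inl K V W) (LinearMap.snd K V W)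

/-- The element of `SplitEnd K V W` with block matrix `(S, f; 0, R)`. -/
def splitBlock (S : Module.End K V) (f : W →ₗ[K] V) (R : Module.End K W) : SplitEnd K V W :=
  ⟨(S, block S f R, R), LinearMap.ext fun v => by simp, rfl⟩

theorem exists_eq_splitBlock (X : SplitEnd K V W) : ∃ S f R, X = splitBlock S f R := by
  obtain ⟨⟨S, Y, R⟩, h1, h2⟩ := X
  obtain ⟨S', f, rfl⟩ := (snd_comp_eq_iff Y R).1 h2
  have : S = S' := LinearMap.ext fun v => by
    simpa using congrArg Prod.fst (LinearMap.congr_fun h1 v)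
  subst this
  exact ⟨S, f, R, rfl⟩

/-- The projection `(X_V, X_Z, X_W) ↦ X_Z`. -/
def midEnd (K V W : Type*) [Field K] [AddCommGroup V] [Module K V] [AddCommGroup W]
    [Module K W] : SplitEnd K V W →+* Module.End K (V × W) :=
  ((RingHom.fst _ _).comp (RingHom.snd _ _)).comp (Subring.subtype _)

theorem midEnd_splitBlock (S : Module.End K V) (f : W →ₗ[K] V) (R : Module.End K W) :
    midEnd K V W (splitBlock S f R) = block S f R := rfl

theorem projEnd_splitBlock (S : Module.End K V) (f : W →ₗ[K] V) (R : Module.End K W) :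
    projEnd _ _ (splitBlock S f R) = R := rfl

/-- The component at Z determines the others, so commutation and nilpotency can be tested there. -/
theorem midEnd_injective : Function.Injective (midEnd K V W) := by
  intro X Y h
  obtain ⟨S, f, R, rfl⟩ := exists_eq_splitBlock X
  obtain ⟨S', f', R', rfl⟩ := exists_eq_splitBlock Y
  obtain ⟨rfl, rfl, rfl⟩ := block_injective h
  rfl

theorem snd_comp_midEnd (X : SplitEnd K V W) :
    LinearMap.snd K V W ∘ₗ midEnd K V W X = projEnd _ _ X ∘ₗ LinearMap.snd K V W :=
  X.2.2

/-- The inverse must lie in the subring, so it is exhibited: (u, f; 0, v)⁻¹ = (u⁻¹, -u⁻¹ f v⁻¹; 0,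
v⁻¹). -/
theorem isUnit_splitBlock {S : Module.End K V} (hS : IsUnit S) (f : W →ₗ[K] V)
    {R : Module.End K W} (hR : IsUnit R) : IsUnit (splitBlock S f R) := by
  obtain ⟨u, rfl⟩ := hS
  obtain ⟨v, rfl⟩ := hR
  have h1 : block 1 0 1 = (1 : Module.End K (V × W)) := LinearMap.ext fun x => by simp
  refine ⟨⟨splitBlock (u : Module.End K V) f v, splitBlock ((u⁻¹ : (Module.End K V)ˣ) : Module.End K V)
    (-(((u⁻¹ : (Module.End K V)ˣ) : Module.End K V) ∘ₗ f ∘ₗ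
      ((v⁻¹ : (Module.End K W)ˣ) : Module.End K W))) ((v⁻¹ : (Module.End K W)ˣ) : Module.End K W),
    midEnd_injective ?_, midEnd_injective ?_⟩, rfl⟩
  · rw [map_mul, map_one, midEnd_splitBlock, midEnd_splitBlock, block_mul, Units.mul_inv,
      Units.mul_inv, ← h1, LinearMap.comp_neg, ← LinearMap.comp_assoc, ← Module.End.mul_eq_comp,
      Units.mul_inv, Module.End.one_eq_id, LinearMap.id_comp, neg_add_cancel]
  · rw [map_mul, map_one, midEnd_splitBlock, midEnd_splitBlock, block_mul, Units.inv_mul,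
      Units.inv_mul, ← h1, LinearMap.neg_comp, LinearMap.comp_assoc, LinearMap.comp_assoc,
      ← Module.End.mul_eq_comp _ (v : Module.End K W),
      Units.inv_mul]
    exact congrArg (fun z => block 1 z 1) (add_neg_cancel _)

theorem conjAction_mem_liftNilpotent {G : Subgroup (Module.End K W)ˣ} {A : Set (Module.End K W)}
    (hGA : ∀ g ∈ G, ∀ X ∈ A,
      (g : Module.End K W) * X * ((g⁻¹ : (Module.End K W)ˣ) : Module.End K W) ∈ A) :
    ∀ g ∈ liftGroup (LinearMap.inl K V W) (LinearMap.snd K V W) G,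
      ∀ X ∈ liftNilpotent (LinearMap.inl K V W) (LinearMap.snd K V W) A,
        conjAction _ g X ∈ liftNilpotent (LinearMap.inl K V W) (LinearMap.snd K V W) A := by
  rintro g hg X ⟨hX, n, hn⟩
  refine ⟨?_, n, ?_⟩
  · rw [conjAction_apply, map_mul, map_mul]
    exact hGA _ hg _ hX
  · rw [conjAction_apply, Units.conj_pow, hn, mul_zero, zero_mul]

variable [Finite V] [Finite W]

theorem isUnit_iff_midEnd (X : SplitEnd K V W) : IsUnit X ↔ IsUnit (midEnd K V W X) := by
  refine ⟨fun h => h.map _, fun h => ?_⟩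
  obtain ⟨S, f, R, rfl⟩ := exists_eq_splitBlock X
  obtain ⟨hS, hR⟩ := (isUnit_block S f R).1 h
  exact isUnit_splitBlock hS f hR

/-- Over each g, the invertible block S and the corner f are free. -/
theorem natCard_liftGroup (G : Subgroup (Module.End K W)ˣ) :
    Nat.card (liftGroup (LinearMap.inl K V W) (LinearMap.snd K V W) G) =
      Nat.card G * (Nat.card (Module.End K V)ˣ * Nat.card (W →ₗ[K] V)) := by
  let π : liftGroup (LinearMap.inl K V W) (LinearMap.snd K V W) G → G := fun u =>
    ⟨Units.map (projEnd (LinearMap.inl K V W) (LinearMap.snd K V W) :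
      SplitEnd K V W →* Module.End K W) u.1, u.2⟩
  refine natCard_eq_mul_of_fiber π _ fun g => ?_
  rw [natCard_units, ← Nat.card_prod]
  symm
  have hu : ∀ x : {S : Module.End K V // IsUnit S} × (W →ₗ[K] V),
      IsUnit (splitBlock x.1.1 x.2 (g.1 : Module.End K W)) := fun x =>
    isUnit_splitBlock x.1.2 _ g.1.isUnit
  have hg : ∀ x : {S : Module.End K V // IsUnit S} × (W →ₗ[K] V),
      Units.map (projEnd (LinearMap.inl K V W) (LinearMap.snd K V W) :
        SplitEnd K V W →* Module.End K W) (hu x).unit = g := fun x => Units.ext rfl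
  refine Nat.card_congr (Equiv.ofBijective (fun x => ⟨⟨(hu x).unit, by
    rw [liftGroup, Subgroup.mem_comap, hg x]; exact g.2⟩, Subtype.ext (hg x)⟩) ⟨?_, ?_⟩)
  · rintro ⟨⟨S, hS⟩, f⟩ ⟨⟨S', hS'⟩, f'⟩ e
    have e1 : splitBlock S f (g.1 : Module.End K W) = splitBlock S' f' g.1 :=
      congrArg (fun z => (z.1.1 : SplitEnd K V W)) e
    obtain ⟨rfl, rfl, -⟩ := block_injective (congrArg (midEnd K V W) e1)
    rfl
  · rintro ⟨⟨u, hu'⟩, hug⟩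
    obtain ⟨S, f, R, hX⟩ := exists_eq_splitBlock (u : SplitEnd K V W)
    have hR : R = (g.1 : Module.End K W) := by
      rw [← projEnd_splitBlock S f R, ← hX]
      exact congrArg (fun z : G => (z.1 : Module.End K W)) hug
    subst hR
    have hS : IsUnit S := by
      have := (isUnit_iff_midEnd _).1 u.isUnit
      rw [hX] at this
      exact ((isUnit_block S f _).1 this).1
    exact ⟨⟨⟨S, hS⟩, f⟩, Subtype.ext (Subtype.ext (Units.ext hX.symm))⟩

theorem exists_midEnd_eq_of_mem_lifts (g : (Module.End K W)ˣ) (R : Module.End K W)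
    {H Y : Module.End K (V × W)}
    (h : (H, Y) ∈ lifts (LinearMap.snd K V W) (g : Module.End K W) R) :
    ∃ (u : (SplitEnd K V W)ˣ) (X : SplitEnd K V W), midEnd K V W u = H ∧ midEnd K V W X = Y ∧
      Units.map (projEnd (LinearMap.inl K V W) (LinearMap.snd K V W) :
        SplitEnd K V W →* Module.End K W) u = g ∧ projEnd _ _ X = R := by
  obtain ⟨⟨h1, -⟩, h2, h3⟩ := h
  obtain ⟨S, α, rfl⟩ := (snd_comp_eq_iff H (g : Module.End K W)).1 h2
  obtain ⟨T, β, rfl⟩ := (snd_comp_eq_iff Y R).1 h3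
  have hu : IsUnit (splitBlock S α (g : Module.End K W)) := (isUnit_iff_midEnd _).2 h1
  exact ⟨hu.unit, splitBlock T β R, rfl, rfl, Units.ext rfl, rfl⟩

/-- Conjugation fixes X exactly when the two commute; `midEnd` turns such pairs into lifts of their
images in G × A. -/
theorem orbitCount_liftNilpotent_mul {G : Subgroup (Module.End K W)ˣ}
    {A : Set (Module.End K W)} [Fintype (commutingPairs G A)]
    (hGA : ∀ g ∈ G, ∀ X ∈ A,
      (g : Module.End K W) * X * ((g⁻¹ : (Module.End K W)ˣ) : Module.End K W) ∈ A) :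
    orbitCount (conjAction (SplitEnd K V W)) (liftGroup _ _ G) (liftNilpotent _ _ A) *
      Nat.card (liftGroup (LinearMap.inl K V W) (LinearMap.snd K V W) G) =
      ∑ x : commutingPairs G A,
        Nat.card (lifts (LinearMap.snd K V W) (x.1.1 : Module.End K W) x.1.2) := by
  rw [orbitCount_mul_natCard _ _ _ (conjAction_mem_liftNilpotent hGA), ← Nat.card_sigma]
  have hc : ∀ X Y : SplitEnd K V W,
      Commute (midEnd K V W X) (midEnd K V W Y) ↔ Commute X Y := fun X Y => by
    rw [commute_iff_eq, commute_iff_eq, ← map_mul, ← map_mul, midEnd_injective.eq_iff]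
  let π : (SplitEnd K V W)ˣ →* (Module.End K W)ˣ := Units.map
    (projEnd (LinearMap.inl K V W) (LinearMap.snd K V W) : SplitEnd K V W →* Module.End K W)
  let B : Set ((SplitEnd K V W)ˣ × SplitEnd K V W) := {x | x.1 ∈ liftGroup _ _ G ∧
    x.2 ∈ liftNilpotent _ _ A ∧ conjAction (SplitEnd K V W) x.1 x.2 = x.2}
  have hB : ∀ x ∈ B, Commute (x.1 : SplitEnd K V W) x.2 := fun x hx =>
    (conjAction_eq_self_iff _ _).1 hx.2.2
  have hT : ∀ x ∈ B, (π x.1, projEnd _ _ x.2) ∈ commutingPairs G A := fun x hx =>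
    ⟨hx.1, hx.2.1.1, (hB x hx).map (projEnd _ _)⟩
  have hL : ∀ x ∈ B, (midEnd K V W x.1, midEnd K V W x.2) ∈
      lifts (LinearMap.snd K V W) (π x.1 : Module.End K W) (projEnd _ _ x.2) := fun x hx =>
    ⟨⟨x.1.isUnit.map _, (hB x hx).map _, hx.2.1.2.map _⟩, snd_comp_midEnd _, snd_comp_midEnd _⟩
  let Φ : B → Σ x : commutingPairs G A,
      lifts (LinearMap.snd K V W) (x.1.1 : Module.End K W) x.1.2 := fun x =>
    ⟨⟨(π x.1.1, projEnd _ _ x.1.2), hT x.1 x.2⟩, (midEnd K V W x.1.1, midEnd K V W x.1.2),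
      hL x.1 x.2⟩
  refine Nat.card_congr (Equiv.ofBijective Φ ⟨?_, ?_⟩)
  · rintro ⟨⟨h, X⟩, hx⟩ ⟨⟨h', X'⟩, hx'⟩ e
    have e2 : (midEnd K V W h, midEnd K V W X) = (midEnd K V W h', midEnd K V W X') :=
      congrArg (fun z => z.2.1) e
    obtain ⟨e3, e4⟩ := Prod.ext_iff.1 e2
    obtain rfl := Units.ext (midEnd_injective e3)
    obtain rfl := midEnd_injective e4
    rfl
  · rintro ⟨⟨⟨g, R⟩, hT'⟩, ⟨⟨H, Y⟩, hy⟩⟩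
    obtain ⟨u, X, rfl, rfl, hu, rfl⟩ := exists_midEnd_eq_of_mem_lifts g R hy
    have hg' : π u = g := hu
    subst hg'
    have hx : (u, X) ∈ B := ⟨hT'.1, ⟨hT'.2.1, (IsNilpotent.map_iff midEnd_injective).1 hy.1.2.2⟩,
      (conjAction_eq_self_iff _ _).2 ((hc _ _).1 hy.1.2.1)⟩
    exact ⟨⟨(u, X), hx⟩, rfl⟩

/-- Of the two extra factors in the order of the lifted group, |Hom(W, K^j)| cancels against the
number of corners and |GL_j| is the denominator in `nilSeries`. -/
theorem gammaLift_mul_natCard [Finite K] {G : Subgroup (Module.End K W)ˣ}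
    {A : Set (Module.End K W)} [Fintype (commutingPairs G A)] (j : ℕ)
    (hA : ∀ X ∈ A, IsNilpotent X)
    (hGA : ∀ g ∈ G, ∀ X ∈ A,
      (g : Module.End K W) * X * ((g⁻¹ : (Module.End K W)ˣ) : Module.End K W) ∈ A) :
    (gammaLift j G A : ℚ) * Nat.card G = ∑ x : commutingPairs G A,
      PowerSeries.coeff j (nilSeries (x.1.1 : Module.End K W) x.1.2 ⊤) := by
  have h1 := orbitCount_liftNilpotent_mul (V := Fin j → K) hGA
  have h2 : ∀ x : commutingPairs G A, Nat.card (lifts (LinearMap.snd K (Fin j → K) W)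
      (x.1.1 : Module.End K W) x.1.2) = Nat.card (W →ₗ[K] (Fin j → K)) *
        Nat.card (nilHoms (Fin j → K) (x.1.1 : Module.End K W) x.1.2 ⊤) := fun x =>
    natCard_lifts_snd _ _ ⟨x.1.1.isUnit, x.2.2.2, hA _ x.2.2.1⟩
  rw [natCard_liftGroup, Finset.sum_congr rfl fun x _ => h2 x, ← Finset.mul_sum] at h1
  have h3 : gammaLift j G A * Nat.card G * Nat.card (Module.End K (Fin j → K))ˣ =
      ∑ x : commutingPairs G A,
        Nat.card (nilHoms (Fin j → K) (x.1.1 : Module.End K W) x.1.2 ⊤) := by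
    refine Nat.eq_of_mul_eq_mul_left (Nat.card_pos (α := W →ₗ[K] (Fin j → K))) ?_
    rw [← h1, gammaLift]
    ring
  have h0 : (Nat.card (Module.End K (Fin j → K))ˣ : ℚ) ≠ 0 := Nat.cast_ne_zero.2 Nat.card_pos.ne'
  simp only [nilSeries, PowerSeries.coeff_mk]
  rw [← Finset.sum_div, eq_div_iff h0]
  exact_mod_cast h3

end BlockRing

/-! ### Nilpotent similarity classes, independently of the field -/

open Polynomial

theorem ncard_image_eq_of_iff {X Y Z : Type*} (f : X → Y) (g : X → Z) (S : Set X)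
    (h : ∀ x ∈ S, ∀ y ∈ S, f x = f y ↔ g x = g y) : (f '' S).ncard = (g '' S).ncard := by
  have hk : Setoid.ker (fun x : S => f x) = Setoid.ker (fun x : S => g x) :=
    Setoid.ext fun x y => h x x.2 y y.2
  rw [Set.image_eq_range, Set.image_eq_range, ← Nat.card_coe_set_eq, ← Nat.card_coe_set_eq,
    ← Nat.card_congr (Setoid.quotientKerEquivRange fun x : S => f x),
    ← Nat.card_congr (Setoid.quotientKerEquivRange fun x : S => g x), hk]

/-- The sequences of dimensions of kernels of powers of nilpotent operators on a space of
dimension `j`. -/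
def kernelProfiles (j : ℕ) : Set (ℕ → ℕ) :=
  {f | ∃ (d : ℕ) (k : Fin d → ℕ), ∑ i, k i = j ∧ f = fun n => ∑ i, min n (k i)}

section Truncated

variable (K : Type*) [Field K]

/-- The module `K[X] / (Xᵏ)`. -/
abbrev Truncated (k : ℕ) : Type _ := K[X] ⧸ Ideal.span {(X : K[X]) ^ k}

instance (k : ℕ) : Module.Finite K (Truncated K k) :=
  (monic_X_pow k).finite_quotient

theorem finrank_truncated (k : ℕ) : Module.finrank K (Truncated K k) = k := by
  rw [finrank_quotient_span_eq_natDegree, natDegree_X_pow]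

theorem natCard_truncated [Finite K] (k : ℕ) : Nat.card (Truncated K k) = Nat.card K ^ k := by
  rw [Module.natCard_eq_pow_finrank (K := K), finrank_truncated]

/-- The torsion is generated by X^(k-n), whose annihilator is generated by X^min(n,k); truncated
subtraction covers n ≥ k. -/
theorem natCard_truncated_torsion [Finite K] (n k : ℕ) :
    Nat.card {x : Truncated K k // (X : K[X]) ^ n • x = 0} = Nat.card K ^ min n k := by
  have hX : ∀ a : ℕ, (X : K[X]) ^ a ≠ 0 := fun a => pow_ne_zero a X_ne_zero
  let f : K[X] →ₗ[K[X]] Truncated K k :=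
    (Submodule.mkQ _).comp (LinearMap.mulLeft K[X] (X ^ (k - n)))
  have hk : X ^ k = (X : K[X]) ^ (k - n) * X ^ min n k := by
    rw [← pow_add]
    congr 1
    omega
  have hmk : ∀ p : K[X], (Submodule.mkQ (Ideal.span {(X : K[X]) ^ k})) p = 0 ↔ X ^ k ∣ p := by
    intro p
    rw [Submodule.mkQ_apply, Submodule.Quotient.mk_eq_zero, Ideal.mem_span_singleton]
  have hker : LinearMap.ker f = Ideal.span {(X : K[X]) ^ min n k} := by
    ext p
    rw [LinearMap.mem_ker, Ideal.mem_span_singleton]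
    change (Submodule.mkQ (Ideal.span {(X : K[X]) ^ k})) (X ^ (k - n) * p) = 0 ↔ _
    rw [hmk, hk, mul_dvd_mul_iff_left (hX _)]
  have hrange : ∀ x : Truncated K k, x ∈ LinearMap.range f ↔ (X : K[X]) ^ n • x = 0 := by
    intro x
    obtain ⟨p, rfl⟩ := Submodule.mkQ_surjective _ x
    rw [← map_smul, hmk, smul_eq_mul]
    constructor
    · rintro ⟨r, hr⟩
      have h1 : X ^ k ∣ X ^ (k - n) * r - p := by
        rw [← hmk, map_sub, sub_eq_zero]
        exact hr
      have h2 : X ^ k ∣ (X : K[X]) ^ n * (X ^ (k - n) * r) := by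
        rw [← mul_assoc, ← pow_add]
        exact Dvd.dvd.mul_right (pow_dvd_pow _ (by omega)) _
      have h3 := dvd_sub h2 (Dvd.dvd.mul_left h1 (X ^ n))
      rwa [mul_sub, sub_sub_cancel] at h3
    · intro h
      rcases le_total n k with hnk | hnk
      · have : (X : K[X]) ^ k = X ^ n * X ^ (k - n) := by
          rw [← pow_add]
          congr 1
          omega
        rw [this, mul_dvd_mul_iff_left (hX _)] at h
        obtain ⟨r, rfl⟩ := h
        exact ⟨r, rfl⟩
      · refine ⟨p, ?_⟩
        change (Submodule.mkQ (Ideal.span {(X : K[X]) ^ k})) (X ^ (k - n) * p) = _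
        rw [Nat.sub_eq_zero_of_le hnk, pow_zero, one_mul]
  rw [← natCard_truncated]
  refine Nat.card_congr ?_
  exact (Equiv.subtypeEquivRight fun x => (hrange x).symm).trans
    ((Submodule.quotEquivOfEq _ _ hker.symm).trans f.quotKerEquivRange).symm.toEquiv

/-- The negated second difference of n ↦ min n l is the indicator of l, so profiles determine the
multiplicities of nonzero parts. Zero parts are invisible. -/
theorem card_filter_eq_of_sum_min_eq {d d' : ℕ} {k : Fin d → ℕ} {k' : Fin d' → ℕ}
    (h : ∀ n, ∑ i, min n (k i) = ∑ i, min n (k' i)) (c : ℕ) (hc : c ≠ 0) :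
    (Finset.univ.filter fun i => k i = c).card = (Finset.univ.filter fun i => k' i = c).card := by
  obtain ⟨m, rfl⟩ := Nat.exists_eq_succ_of_ne_zero hc
  have key : ∀ {e : ℕ} (l : Fin e → ℕ), 2 * ∑ i, min (m + 1) (l i) =
      (Finset.univ.filter fun i => l i = m + 1).card + ∑ i, min (m + 2) (l i) +
        ∑ i, min m (l i) := by
    intro e l
    rw [Finset.card_filter, Finset.mul_sum, ← Finset.sum_add_distrib, ← Finset.sum_add_distrib]
    refine Finset.sum_congr rfl fun i _ => ?_
    split_ifs <;> omega
  have h1 := key k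
  have h2 := key k'
  rw [h, h, h] at h1
  simp only [Nat.succ_eq_add_one]
  omega

/-- Zero factors may be omitted from a product of truncated polynomial modules. -/
theorem nonempty_equiv_ne_zero {d : ℕ} (k : Fin d → ℕ) :
    Nonempty ((∀ i, Truncated K (k i)) ≃ₗ[K[X]] ∀ i : {i // k i ≠ 0}, Truncated K (k i)) := by
  let f : (∀ i, Truncated K (k i)) →ₗ[K[X]] ∀ i : {i // k i ≠ 0}, Truncated K (k i) :=
    LinearMap.pi fun i => LinearMap.proj i.1
  have hsub : ∀ i, k i = 0 → Subsingleton (Truncated K (k i)) := by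
    intro i hi
    rw [hi]
    exact Submodule.Quotient.subsingleton_iff.2 (by simp)
  refine ⟨LinearEquiv.ofBijective f ⟨fun x y hxy => funext fun i => ?_, fun y => ?_⟩⟩
  · by_cases hi : k i = 0
    · have := hsub i hi
      exact Subsingleton.elim _ _
    · exact congrFun hxy ⟨i, hi⟩
  · refine ⟨fun i => if hi : k i ≠ 0 then y ⟨i, hi⟩ else 0, funext fun i => ?_⟩
    exact dif_pos i.2

theorem nonempty_equiv_of_sum_min_eq {d d' : ℕ} {k : Fin d → ℕ} {k' : Fin d' → ℕ}
    (h : ∀ n, ∑ i, min n (k i) = ∑ i, min n (k' i)) :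
    Nonempty ((∀ i, Truncated K (k i)) ≃ₗ[K[X]] ∀ i, Truncated K (k' i)) := by
  have hfib : ∀ c, Nonempty ({i : {i // k i ≠ 0} // k i = c} ≃ {i : {i // k' i ≠ 0} // k' i = c}) := by
    intro c
    by_cases hc : c = 0
    · subst hc
      have : IsEmpty {i : {i // k i ≠ 0} // k i = 0} := ⟨fun i => i.1.2 i.2⟩
      have : IsEmpty {i : {i // k' i ≠ 0} // k' i = 0} := ⟨fun i => i.1.2 i.2⟩
      exact ⟨Equiv.equivOfIsEmpty _ _⟩
    · have e : ∀ {e : ℕ} (l : Fin e → ℕ),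
          Nonempty ({i : {i // l i ≠ 0} // l i = c} ≃ {i // l i = c}) := fun l =>
        ⟨Equiv.subtypeSubtypeEquivSubtype fun {i} (hi : l i = c) => hi.trans_ne hc⟩
      have hcard := card_filter_eq_of_sum_min_eq h c hc
      rw [← Fintype.card_subtype, ← Fintype.card_subtype] at hcard
      exact ⟨(e k).some.trans ((Fintype.equivOfCardEq hcard).trans (e k').some.symm)⟩
  let σ := Equiv.ofFiberEquiv fun c => (hfib c).some
  have hσ : ∀ i : {i // k i ≠ 0}, k' (σ i) = k i := fun i =>
    Equiv.ofFiberEquiv_map (fun c => (hfib c).some) i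
  have eR : ∀ i : {i // k i ≠ 0}, Truncated K (k i) ≃ₗ[K[X]] Truncated K (k' (σ i)) := fun i =>
    Submodule.quotEquivOfEq _ _ (by rw [hσ])
  exact ⟨(nonempty_equiv_ne_zero K k).some.trans ((LinearEquiv.piCongrRight eR).trans
    ((LinearEquiv.piCongrLeft K[X] (fun i : {i // k' i ≠ 0} => Truncated K (k' i)) σ).trans
      (nonempty_equiv_ne_zero K k').some.symm))⟩

end Truncated

section Nilpotent

variable {K V : Type*} [Field K] [AddCommGroup V] [Module K V]

theorem sum_eq_finrank {S : Module.End K V} {d : ℕ} {k : Fin d → ℕ}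
    (e : Module.AEval' S ≃ₗ[K[X]] ∀ i, Truncated K (k i)) : ∑ i, k i = Module.finrank K V := by
  rw [((Module.AEval'.of S).trans (e.restrictScalars K)).finrank_eq,
    Module.finrank_pi_fintype]
  simp only [finrank_truncated]

theorem natCard_ker_pow [Finite K] {S : Module.End K V} {d : ℕ} {k : Fin d → ℕ}
    (e : Module.AEval' S ≃ₗ[K[X]] ∀ i, Truncated K (k i)) (n : ℕ) :
    Nat.card (LinearMap.ker (S ^ n)) = Nat.card K ^ ∑ i, min n (k i) := by
  have h1 : Nat.card (LinearMap.ker (S ^ n)) =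
      Nat.card {x : ∀ i, Truncated K (k i) // ∀ i, (X : K[X]) ^ n • x i = 0} := by
    refine Nat.card_congr
      (((Module.AEval'.of S).toEquiv.trans e.toEquiv).subtypeEquiv fun v => ?_)
    change (S ^ n) v = 0 ↔ ∀ i, ((X : K[X]) ^ n • e (Module.AEval'.of S v)) i = 0
    rw [← map_smul, Module.AEval'.X_pow_smul_of]
    exact ((LinearEquiv.map_eq_zero_iff e).trans
      (LinearEquiv.map_eq_zero_iff (Module.AEval'.of S))).symm.trans funext_iff
  rw [h1, Nat.card_congr (Equiv.subtypePiEquivPi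
    (p := fun i (x : Truncated K (k i)) => (X : K[X]) ^ n • x = 0)), Nat.card_pi, ← Finset.prod_pow_eq_pow_sum]
  simp only [natCard_truncated_torsion]

theorem exists_conj_of_equiv {S T : Module.End K V}
    (e : Module.AEval' S ≃ₗ[K[X]] Module.AEval' T) :
    ∃ u : (Module.End K V)ˣ, (u : Module.End K V) * S * ((u⁻¹ : (Module.End K V)ˣ) :
      Module.End K V) = T := by
  let f : V ≃ₗ[K] V := (Module.AEval'.of S).trans
    ((e.restrictScalars K).trans (Module.AEval'.of T).symm)
  have hf : ∀ v, f (S v) = T (f v) := by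
    intro v
    apply (Module.AEval'.of T).injective
    rw [← Module.AEval'.X_smul_of]
    simp only [f, LinearEquiv.trans_apply, LinearEquiv.apply_symm_apply,
      LinearEquiv.restrictScalars_apply]
    rw [← map_smul, Module.AEval'.X_smul_of]
  refine ⟨LinearMap.GeneralLinearGroup.ofLinearEquiv f, ?_⟩
  rw [Units.mul_inv_eq_iff_eq_mul]
  exact LinearMap.ext hf

variable [FiniteDimensional K V]

/-- A nilpotent S makes V an X-power torsion module over the principal ideal domain K[X]. -/
theorem exists_equiv_pi_truncated {S : Module.End K V} (hS : IsNilpotent S) :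
    ∃ (d : ℕ) (k : Fin d → ℕ), Nonempty (Module.AEval' S ≃ₗ[K[X]] ∀ i, Truncated K (k i)) := by
  obtain ⟨n, hn⟩ := hS
  have ht : Module.IsTorsion' (Module.AEval' S) (Submonoid.powers (X : K[X])) := by
    intro x
    obtain ⟨v, rfl⟩ := (Module.AEval'.of S).surjective x
    refine ⟨⟨X ^ n, n, rfl⟩, ?_⟩
    change (X : K[X]) ^ n • Module.AEval'.of S v = 0
    rw [Module.AEval'.X_pow_smul_of, hn, zero_smul, map_zero]
  obtain ⟨d, k, ⟨e⟩⟩ := Module.torsion_by_prime_power_decomposition irreducible_X ht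
  exact ⟨d, k, ⟨e.trans (DirectSum.linearEquivFunOnFintype _ _ _)⟩⟩

theorem exists_isNilpotent_equiv {d : ℕ} (k : Fin d → ℕ) (hk : ∑ i, k i = Module.finrank K V) :
    ∃ S : Module.End K V, IsNilpotent S ∧
      Nonempty (Module.AEval' S ≃ₗ[K[X]] ∀ i, Truncated K (k i)) := by
  let M := ∀ i, Truncated K (k i)
  have hM : Module.finrank K V = Module.finrank K M := by
    rw [Module.finrank_pi_fintype, ← hk]
    simp only [finrank_truncated]
  let f : V ≃ₗ[K] M := LinearEquiv.ofFinrankEq V M hM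
  let S : Module.End K V := f.symm.conj (Algebra.lsmul K K M (X : K[X]))
  have hS : ∀ v, f (S v) = (X : K[X]) • f v := fun v => by
    simp [S, LinearEquiv.conj_apply]
  have hSn : ∀ (n : ℕ) v, f ((S ^ n) v) = (X : K[X]) ^ n • f v := by
    intro n
    induction n with
    | zero => intro v; simp
    | succ n ih =>
      intro v
      rw [pow_succ', Module.End.mul_apply, hS, ih, smul_smul, pow_succ']
  refine ⟨S, ⟨∑ i, k i, LinearMap.ext fun v => f.injective (funext fun i => ?_)⟩,
    ⟨LinearEquiv.ofAEval S f fun v => hS v⟩⟩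
  rw [hSn, LinearMap.zero_apply, map_zero, Pi.smul_apply, Pi.zero_apply]
  obtain ⟨p, hp⟩ := Submodule.mkQ_surjective _ (f v i)
  rw [← hp, ← map_smul, Submodule.mkQ_apply, Submodule.Quotient.mk_eq_zero,
    Ideal.mem_span_singleton, smul_eq_mul]
  exact Dvd.dvd.mul_right (pow_dvd_pow _ (Finset.single_le_sum (fun _ _ => Nat.zero_le _)
    (Finset.mem_univ i))) _

/-- The sizes of ker Sⁿ are a complete conjugacy invariant. They are |K| to the power of the
profile, and |K| > 1, so the count depends on the dimension alone. -/
theorem orbitCount_isNilpotent [Finite K] :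
    orbitCount (conjAction (Module.End K V)) ⊤ {S | IsNilpotent S} =
      (kernelProfiles (Module.finrank K V)).ncard := by
  let q : (ℕ → ℕ) → ℕ → ℕ := fun f n => Nat.card K ^ f n
  have hq : Function.Injective q := fun f f' h => funext fun n =>
    Nat.pow_right_injective Finite.one_lt_card (congrFun h n)
  let φ : Module.End K V → ℕ → ℕ := fun S n => Nat.card (LinearMap.ker (S ^ n))
  have himage : φ '' {S | IsNilpotent S} = q '' kernelProfiles (Module.finrank K V) := by
    ext f
    constructor
    · rintro ⟨S, hS, rfl⟩
      obtain ⟨d, k, ⟨e⟩⟩ := exists_equiv_pi_truncated hS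
      exact ⟨_, ⟨d, k, sum_eq_finrank e, rfl⟩, funext fun n => (natCard_ker_pow e n).symm⟩
    · rintro ⟨_, ⟨d, k, hk, rfl⟩, rfl⟩
      obtain ⟨S, hS, ⟨e⟩⟩ := exists_isNilpotent_equiv k hk
      exact ⟨S, hS, funext fun n => natCard_ker_pow e n⟩
  rw [← Set.ncard_image_of_injective _ hq, ← himage]
  refine ncard_image_eq_of_iff _ _ _ fun S hS T hT => ⟨fun h => ?_, fun h => ?_⟩
  · have hmem : T ∈ {y | ∃ g ∈ (⊤ : Subgroup (Module.End K V)ˣ),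
        conjAction (Module.End K V) g S = y} := by
      rw [h]
      exact ⟨1, Subgroup.mem_top _, by simp⟩
    obtain ⟨u, -, rfl⟩ := hmem
    funext n
    have hu := (Module.End.isUnit_iff _).1 u.isUnit
    refine Nat.card_congr ((Equiv.ofBijective _ hu).subtypeEquiv fun v => ?_)
    rw [LinearMap.mem_ker, LinearMap.mem_ker, conjAction_apply, Units.conj_pow]
    have : ((u : Module.End K V) * S ^ n * ((u⁻¹ : (Module.End K V)ˣ) : Module.End K V))
        ((u : Module.End K V) v) = (u : Module.End K V) ((S ^ n) v) := by
      rw [← Module.End.mul_apply, mul_assoc, Units.inv_mul, mul_one, Module.End.mul_apply]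
    change _ ↔ ((u : Module.End K V) * S ^ n * ((u⁻¹ : (Module.End K V)ˣ) : Module.End K V))
        ((u : Module.End K V) v) = 0
    rw [this, map_eq_zero_iff _ hu.1]
  · obtain ⟨d, k, ⟨e⟩⟩ := exists_equiv_pi_truncated hS
    obtain ⟨d', k', ⟨e'⟩⟩ := exists_equiv_pi_truncated hT
    have hmin : ∀ n, ∑ i, min n (k i) = ∑ i, min n (k' i) := fun n =>
      Nat.pow_right_injective Finite.one_lt_card
        ((natCard_ker_pow e n).symm.trans ((congrFun h n).trans (natCard_ker_pow e' n)))
    obtain ⟨u, rfl⟩ := exists_conj_of_equiv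
      (e.trans ((nonempty_equiv_of_sum_min_eq K hmin).some.trans e'.symm))
    ext y
    constructor
    · rintro ⟨g, -, rfl⟩
      refine ⟨g * u⁻¹, Subgroup.mem_top _, ?_⟩
      rw [← conjAction_apply, ← Equiv.Perm.mul_apply, ← map_mul, inv_mul_cancel_right]
    · rintro ⟨g, -, rfl⟩
      exact ⟨g * u, Subgroup.mem_top _, by rw [map_mul]; rfl⟩

/-- Cauchy–Frobenius for GL(V) acting on nilpotent endomorphisms. -/
theorem natCard_nilPairs [Finite K] [Finite V] : Nat.card (nilPairs K V) =
    (kernelProfiles (Module.finrank K V)).ncard * Nat.card (Module.End K V)ˣ := by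
  have h := orbitCount_mul_natCard (conjAction (Module.End K V)) ⊤ {S | IsNilpotent S} (by
    rintro g - S ⟨n, hn⟩
    exact ⟨n, by rw [conjAction_apply, Units.conj_pow, hn, mul_zero, zero_mul]⟩)
  rw [orbitCount_isNilpotent, Subgroup.card_top] at h
  rw [h]
  refine Nat.card_congr
    { toFun := fun x => ⟨(x.2.1.unit, x.1.2), Subgroup.mem_top _, x.2.2.2,
        (conjAction_eq_self_iff _ _).2 x.2.2.1⟩
      invFun := fun x => ⟨(x.1.1, x.1.2), x.1.1.isUnit, (conjAction_eq_self_iff _ _).1 x.2.2.2,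
        x.2.2.1⟩
      left_inv := fun x => rfl
      right_inv := fun x => Subtype.ext (Prod.ext (Units.ext rfl) rfl) }

theorem ncard_kernelProfiles_zero : (kernelProfiles 0).ncard = 1 := by
  rw [Set.ncard_eq_one]
  refine ⟨0, Set.eq_singleton_iff_unique_mem.2 ⟨⟨0, Fin.elim0, rfl, rfl⟩, ?_⟩⟩
  rintro _ ⟨d, k, hk, rfl⟩
  funext n
  simp_all

end Nilpotent

/-! ### The universal coefficients -/

theorem natCard_nilHoms_bot {K V W : Type*} [Field K] [AddCommGroup V] [Module K V]
    [AddCommGroup W] [Module K W] (g R : Module.End K W) :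
    Nat.card (nilHoms V g R ⊥) = Nat.card (nilPairs K V) := by
  refine Nat.card_congr
    { toFun := fun x => ⟨x.1.1, x.2.1⟩
      invFun := fun x => ⟨(x.1, 0), x.2, Submodule.zero_mem _, by simp⟩
      left_inv := fun x => Subtype.ext (Prod.ext rfl ?_)
      right_inv := fun x => rfl }
  exact (LinearMap.range_eq_bot.1 (le_bot_iff.1 x.2.2.2)).symm

/-- The generating function of the numbers of nilpotent similarity classes. -/
noncomputable def nilpotentClassSeries : PowerSeries ℤ :=
  PowerSeries.mk fun j => (kernelProfiles j).ncard

theorem nilSeries_bot {K W : Type*} [Field K] [Finite K] [AddCommGroup W] [Module K W]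
    (g R : Module.End K W) :
    nilSeries g R ⊥ = PowerSeries.map (Int.castRingHom ℚ) nilpotentClassSeries := by
  ext j
  have h0 : (Nat.card (Module.End K (Fin j → K))ˣ : ℚ) ≠ 0 := Nat.cast_ne_zero.2 Nat.card_pos.ne'
  rw [nilSeries, PowerSeries.coeff_mk, natCard_nilHoms_bot, natCard_nilPairs,
    Module.finrank_fin_fun, Nat.cast_mul, mul_div_cancel_right₀ _ h0, PowerSeries.coeff_map,
    nilpotentClassSeries, PowerSeries.coeff_mk]
  simp

/-- The quotient of `∏ i < m, (1 - Xⁱ⁺¹)` by `nilpotentClassSeries`. -/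
noncomputable def flagSeries (m : ℕ) : PowerSeries ℤ :=
  (∏ i ∈ Finset.range m, (1 - PowerSeries.X ^ (i + 1))) *
    nilpotentClassSeries.invOfUnit 1

theorem flagSeries_mul (m : ℕ) : flagSeries m * nilpotentClassSeries =
    ∏ i ∈ Finset.range m, (1 - PowerSeries.X ^ (i + 1)) := by
  have h : nilpotentClassSeries * nilpotentClassSeries.invOfUnit 1 = 1 := by
    refine PowerSeries.mul_invOfUnit _ _ ?_
    rw [← PowerSeries.coeff_zero_eq_constantCoeff_apply, nilpotentClassSeries,
      PowerSeries.coeff_mk, ncard_kernelProfiles_zero]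
    rfl
  rw [flagSeries, mul_assoc, mul_comm (PowerSeries.invOfUnit _ _), h, mul_one]

/-- The coefficients that express the number of orbits on complete flags. -/
noncomputable def flagCoeff (m j : ℕ) : ℤ :=
  ∑ i ∈ Finset.range (m * (m - 1) / 2 + 1 - j), PowerSeries.coeff i (flagSeries m)

/-- The polynomial P is `nilSeries g R ⊤` times `flagSeries`; its value at 1 is the sum of its
coefficients up to the degree bound. -/
theorem natCard_stableFlags_eq_sum {K W : Type*} [Field K] [Finite K] [AddCommGroup W]
    [Module K W] [Finite W] {g R : Module.End K W} (hgR : (g, R) ∈ nilPairs K W) :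
    (Nat.card (stableFlags g R ⊤ (Module.finrank K W - 1)) : ℚ) =
      ∑ j ∈ Finset.range (Module.finrank K W * (Module.finrank K W - 1) / 2 + 1),
        (flagCoeff (Module.finrank K W) j : ℚ) * PowerSeries.coeff j (nilSeries g R ⊤) := by
  obtain ⟨P, hdeg, hP, hev⟩ := exists_polynomial_eval_one_eq_natCard_stableFlags hgR
    (Module.finrank K W) ⊤ (mem_stableBelow.2 ⟨le_rfl, le_top, le_top⟩) (finrank_top K W)
  let c := PowerSeries.map (Int.castRingHom ℚ)
  have hc0 : nilSeries g R ⊥ ≠ 0 := by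
    intro h
    have h1 := congrArg (PowerSeries.coeff 0) h
    rw [nilSeries_bot, PowerSeries.coeff_map, nilpotentClassSeries, PowerSeries.coeff_mk,
      ncard_kernelProfiles_zero] at h1
    simp at h1
  have hprod : c (flagSeries (Module.finrank K W)) * nilSeries g R ⊥ =
      ∏ i ∈ Finset.range (Module.finrank K W), (1 - PowerSeries.X ^ (i + 1)) := by
    rw [nilSeries_bot, ← map_mul, flagSeries_mul, map_prod]
    simp [c]
  have hPc : (P : PowerSeries ℚ) = nilSeries g R ⊤ * c (flagSeries (Module.finrank K W)) := by
    refine mul_right_cancel₀ hc0 ?_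
    rw [← hP, ← hprod]
    ring
  rw [Finset.sum_range_id] at hdeg
  rw [← hev, Polynomial.eval_eq_sum_range' (Nat.lt_succ_of_le hdeg)]
  have hcoeff : ∀ k, P.coeff k * 1 ^ k = ∑ j ∈ Finset.range (k + 1),
      PowerSeries.coeff j (nilSeries g R ⊤) *
        PowerSeries.coeff (k - j) (c (flagSeries (Module.finrank K W))) := by
    intro k
    rw [one_pow, mul_one, ← Polynomial.coeff_coe, hPc, PowerSeries.coeff_mul,
      Finset.Nat.sum_antidiagonal_eq_sum_range_succ fun i j =>
        PowerSeries.coeff i (nilSeries g R ⊤) *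
          PowerSeries.coeff j (c (flagSeries (Module.finrank K W)))]
  -- Interchanging the triangular sum pairs the j-th coefficient with the indices i ≤ n - j, hence
  -- the range in `flagCoeff`.
  rw [Finset.sum_congr rfl fun k _ => hcoeff k, Nat.succ_eq_add_one,
    Finset.sum_range_diag_flip _ fun j i => PowerSeries.coeff j (nilSeries g R ⊤) *
      PowerSeries.coeff i (c (flagSeries (Module.finrank K W)))]
  refine Finset.sum_congr rfl fun j _ => ?_
  rw [← Finset.mul_sum, mul_comm, flagCoeff, Int.cast_sum]
  simp [c]

end FlagOrbits

/-! ### Assembly -/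

theorem mainTheorem12 (m : ℕ) (hm : 0 < m) :
    ∃ a : ℕ → ℤ,
      ∀ (K : Type*) [Field K] [Finite K] (W : Type*) [AddCommGroup W] [Module K W],
        Module.finrank K W = m →
        ∀ (G : Subgroup (Module.End K W)ˣ) (A : Set (Module.End K W)),
          (∀ X ∈ A, IsNilpotent X) →
          (∀ g ∈ G, ∀ X ∈ A, (g : Module.End K W) * X * ((g⁻¹ : (Module.End K W)ˣ) : Module.End K W) ∈ A) →
          (FlagOrbits.xi (FlagOrbits.staircase m) G A : ℤ) =
            ∑ j ∈ Finset.range (m * (m - 1) / 2 + 1), a j * (FlagOrbits.gammaLift j G A : ℤ) := by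
  refine ⟨FlagOrbits.flagCoeff m, ?_⟩
  intro K _ _ W _ _ hd G A hA hGA
  have : FiniteDimensional K W := FiniteDimensional.of_finrank_pos (hd ▸ hm)
  have : Finite W := Module.finite_of_finite K
  cases nonempty_fintype (FlagOrbits.commutingPairs G A)
  have hG : (Nat.card G : ℚ) ≠ 0 := Nat.cast_ne_zero.2 Nat.card_pos.ne'
  have hpair : ∀ x : FlagOrbits.commutingPairs G A,
      ((x.1.1 : Module.End K W), x.1.2) ∈ FlagOrbits.nilPairs K W := fun x =>
    ⟨x.1.1.isUnit, x.2.2.2, hA _ x.2.2.1⟩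
  -- The comparison takes place over ℚ, where `nilSeries` lives and |G| can be cancelled.
  have key : (FlagOrbits.xi (FlagOrbits.staircase m) G A : ℚ) =
      ∑ j ∈ Finset.range (m * (m - 1) / 2 + 1),
        (FlagOrbits.flagCoeff m j : ℚ) * (FlagOrbits.gammaLift j G A : ℚ) := by
    refine mul_right_cancel₀ hG ?_
    have h1 := congrArg (Nat.cast : ℕ → ℚ) (FlagOrbits.xi_staircase_mul_natCard m hGA)
    rw [Nat.cast_mul, Nat.cast_sum] at h1
    subst hd
    rw [h1, Finset.sum_congr rfl fun x _ => FlagOrbits.natCard_stableFlags_eq_sum (hpair x),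
      Finset.sum_comm, Finset.sum_mul]
    refine Finset.sum_congr rfl fun j _ => ?_
    rw [mul_assoc, FlagOrbits.gammaLift_mul_natCard j hA hGA, Finset.mul_sum]
  exact_mod_cast key
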